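/- Let $X$ and $Y$ be Banach spaces over $\mathbb{K}=\mathbb{R}$ or $\mathbb{C}$, and let $\mathbb{T}=\{\theta\in\mathbb{K}:|\theta|=1\}$. Write $B_Z$ and $S_Z$ for the closed unit ball and the unit sphere of a Banach space $Z$, $\mathcal{L}(X,Y)$ for the Banach space of bounded linear operators from $X$ to $Y$ with the operator norm, and $X^*=\mathcal{L}(X,\mathbb{K})$. Definitions. $\operatorname{NA}(X,Y)$ is the set of those $T\in\mathcal{L}(X,Y)$ with $\|T\|=\|Tx\|$ for some $x\in S_X$. A functional $z^*\in Z^*$ strongly exposes $z_0\in B_Z$ if $\operatorname{Re} z^*(z_0)=\sup_{z\in B_Z}\operatorname{Re} z^*(z)$ and every sequence $(z_n)$ in $B_Z$ with $\operatorname{Re} z^*(z_n)\to\operatorname{Re} z^*(z_0)$ converges in norm to $z_0$; then $z_0$ is a strongly exposed point of $B_Z$. The set of strongly exposed points of $B_Z$ is denoted by $\operatorname{str-exp}(B_Z)$, and the set of functionals that strongly expose some point of $B_Z$ by $\operatorname{SE}(Z)$. $\operatorname{ASE}(X,Y)$ is the set of absolutely strongly exposing operators, that is, of those $T\in\mathcal{L}(X,Y)$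 for which there is $x_0\in B_X$ such that whenever $(x_n)$ is a sequence in $B_X$ with $\|Tx_n\|\to\|T\|$, there are $\theta_n\in\mathbb{T}$ with $\theta_nx_n\to x_0$. A set $A\subseteq Z$ is countable up to rotations if there is a countable $C\subseteq A$ with $A\subseteq\mathbb{T}C$. A Banach space has the Radon--Nikodým property (RNP) if each of its nonempty bounded subsets is dentable, i.e. has slices of arbitrarily small diameter. A subset of a topological space is residual if it contains a countable intersection of dense open sets. Statement. Suppose that $Y^*$ has the RNP and that $\operatorname{str-exp}(B_{Y^*})$ is countable up to rotations. Let $\mathcal{I}(X,Y)$ be a closed linear subspace of $\mathcal{L}(X,Y)$ that contains all rank one operators. (a) If $\operatorname{NA}(X,\mathbb{K})$ is residual in $X^*$, then $\operatorname{NA}(X,Y)\cap\mathcal{I}(X,Y)$ is residual in $\mathcal{I}(X,Y)$. (b) If $\operatorname{SE}(X)$ is dense in $X^*$, then the set of those elements of $\mathcal{I}(X,Y)$ at which the norm of $\mathcal{L}(X,Y)$ is Fréchet differentiable (as a real-valued function on a real normed space) is dense in $\mathcal{I}(X,Y)$; in particular, if $Y\neq\{0\}$, then $\operatorname{ASE}(X,Y)\cap\mathcal{I}(X,Y)$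 is dense in $\mathcal{I}(X,Y)$. Moreover, the hypotheses on $Y$ are satisfied whenever $Y$ is an isometric predual of $\ell_1$, that is, whenever $Y^*$ is linearly isometric to $\ell_1$ over $\mathbb{K}$: then $Y^*$ has the RNP and $\operatorname{str-exp}(B_{Y^*})$ is countable up to rotations. -/

import Mathlib

open Filter Topology

section BanachGeometry

variable (𝕜 : Type*) [RCLike 𝕜]

/-- A subset `C` of a normed space is dentable if it has slices of arbitrarily small diameter.
A slice of `C` is a nonempty intersection of `C` with an open half-space `{x | c < re f x}`,
where `f` is a bounded linear functional. -/
def IsDentable {E : Type*} [NormedAddCommGroup E] [NormedSpace 𝕜 E] (C : Set E) : Prop :=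
  ∀ ε : ℝ, 0 < ε → ∃ (f : StrongDual 𝕜 E) (c : ℝ),
    {x ∈ C | c < RCLike.re (f x)}.Nonempty ∧ Metric.diam {x ∈ C | c < RCLike.re (f x)} < ε

/-- The Radon-Nikodym property of a Banach space: every nonempty bounded subset is dentable. -/
def HasRNP (E : Type*) [NormedAddCommGroup E] [NormedSpace 𝕜 E] : Prop :=
  ∀ C : Set E, C.Nonempty → Bornology.IsBounded C → IsDentable 𝕜 C

variable {𝕜}

/-- The functional `f` strongly exposes the point `x₀` in `C`: its real part attains its supremum
over `C` at `x₀`, and every maximizing sequence in `C` converges in norm to `x₀`. -/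
def StronglyExposes {E : Type*} [NormedAddCommGroup E] [NormedSpace 𝕜 E]
    (f : StrongDual 𝕜 E) (C : Set E) (x₀ : E) : Prop :=
  x₀ ∈ C ∧ (∀ x ∈ C, RCLike.re (f x) ≤ RCLike.re (f x₀)) ∧
    ∀ x : ℕ → E, (∀ n, x n ∈ C) →
      Tendsto (fun n => RCLike.re (f (x n))) atTop (𝓝 (RCLike.re (f x₀))) →
      Tendsto x atTop (𝓝 x₀)

variable (𝕜)

/-- The set of strongly exposed points of `C`. -/
def strExp {E : Type*} [NormedAddCommGroup E] [NormedSpace 𝕜 E] (C : Set E) : Set E :=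
  {x₀ | ∃ f : StrongDual 𝕜 E, StronglyExposes f C x₀}

/-- `SE(E)`: the set of functionals that strongly expose some point of the closed unit ball. -/
def SE (E : Type*) [NormedAddCommGroup E] [NormedSpace 𝕜 E] : Set (StrongDual 𝕜 E) :=
  {f | ∃ x₀ : E, StronglyExposes f (Metric.closedBall 0 1) x₀}

/-- `A` is countable up to rotations: there is a countable subset of `A` of which every element
of `A` is a multiple by a scalar of modulus one. -/
def CountableUpToRotations {E : Type*} [NormedAddCommGroup E] [NormedSpace 𝕜 E]
    (A : Set E) : Prop :=
  ∃ C : Set E, C ⊆ A ∧ C.Countable ∧ ∀ a ∈ A, ∃ c ∈ C, ∃ θ : 𝕜, ‖θ‖ = 1 ∧ a = θ • c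

/-- `NA(X, Y)`: the set of norm attaining operators. -/
def NA (X Y : Type*) [NormedAddCommGroup X] [NormedSpace 𝕜 X]
    [NormedAddCommGroup Y] [NormedSpace 𝕜 Y] : Set (X →L[𝕜] Y) :=
  {T | ∃ x : X, ‖x‖ = 1 ∧ ‖T‖ = ‖T x‖}

/-- `ASE(X, Y)`: the set of absolutely strongly exposing operators. Note that `‖T‖` is the
supremum of `‖T x‖` over the closed unit ball. -/
def ASE (X Y : Type*) [NormedAddCommGroup X] [NormedSpace 𝕜 X]
    [NormedAddCommGroup Y] [NormedSpace 𝕜 Y] : Set (X →L[𝕜] Y) :=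
  {T | ∃ x₀ ∈ Metric.closedBall (0 : X) 1,
    ∀ x : ℕ → X, (∀ n, x n ∈ Metric.closedBall (0 : X) 1) →
      Tendsto (fun n => ‖T (x n)‖) atTop (𝓝 ‖T‖) →
      ∃ θ : ℕ → 𝕜, (∀ n, ‖θ n‖ = 1) ∧ Tendsto (fun n => θ n • x n) atTop (𝓝 x₀)}

/-- The norm of `E` is Fréchet differentiable at `x`, as a real-valued function on the real
normed space underlying `E`. -/
def NormFrechetDifferentiableAt {E : Type*} [NormedAddCommGroup E] [NormedSpace 𝕜 E]
    (x : E) : Prop :=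
  letI : NormedSpace ℝ E := NormedSpace.restrictScalars ℝ 𝕜 E
  DifferentiableAt ℝ (fun y : E => ‖y‖) x

/-- `Y` is an isometric predual of `ℓ₁`. -/
def IsPredualOfEllOne (Y : Type*) [NormedAddCommGroup Y] [NormedSpace 𝕜 Y] : Prop :=
  Nonempty (StrongDual 𝕜 Y ≃ₗᵢ[𝕜] lp (fun _ : ℕ => 𝕜) 1)

end BanachGeometry

/-! The adjoint of a generic operator attains its norm at a strongly exposed point of the dual ball.
Since there are only countably many such points up to rotation, Baire category reduces questions
about operators to questions about the functionals `c ∘ T`, with `c` in a countable set.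

By the RNP, strongly exposing functionals are dense (`dense_smallSlice`: Bishop-Phelps-Bollobás,
obtained from Ekeland's principle, combined with dentability). Strongly exposed points therefore
span a dense subspace, and countability makes `Y*` separable. In a separable dual, Stegall's
principle holds with perturbations from the predual: for `φ(m) = ‖m ∘ T‖` on the dual ball there is
a small `y` such that the near-maximizers of `φ(m) + re m(y)` cluster. The rank one operator `f ⊗
y`, with `f` in the direction of `m₀ ∘ T` for a suitable near-maximizer `m₀`, realizes this
perturbation inside the operator space. Hence for every operator `T` in a dense Gδ of `I` there is
`c` in a countable set `D` with `‖c ∘ T‖ = ‖T‖`.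

For (a), `T ↦ c ∘ T` is open from `I` to `X*`, so the preimages of `NA(X, 𝕜)` are residual and
countably many of them may be intersected. For (b), the closed sets `F c = {‖c ∘ T‖ = ‖T‖}` have
interiors with dense union. Inside such an interior, openness provides `T` with `c ∘ T` strongly
exposing some `x₀`. Small rank one perturbations with values in `ker c` cannot change `‖T‖`, so
every functional almost norming `T` is almost a multiple of `c`. Thus `T` is almost normed only near
`(x₀, c)` up to scalars, which gives both Fréchet differentiability and `ASE`.

If `Y*` is isometric to `ℓ₁`, it is a separable dual, and its strongly exposed points are rotated
basis vectors. -/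

/-! ### Ekeland's principle and a separation argument -/

/-- A function bounded above on a nonempty set has near-maximizers there. -/
lemma exists_near_maximizer {α : Type*} {s : Set α} (hs : s.Nonempty) {f : α → ℝ}
    (hf : BddAbove (f '' s)) {δ : ℝ} (hδ : 0 < δ) : ∃ x ∈ s, ∀ z ∈ s, f z ≤ f x + δ := by
  obtain ⟨_, ⟨x, hx, rfl⟩, hlt⟩ :=
    exists_lt_of_lt_csSup (hs.image f) (sub_lt_self (sSup (f '' s)) hδ)
  exact ⟨x, hx, fun z hz => by linarith [le_csSup hf (Set.mem_image_of_mem f hz)]⟩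

/-- Ekeland's variational principle. -/
theorem ekeland {α : Type*} [MetricSpace α] [CompleteSpace α] {s : Set α} (hs : IsClosed s)
    {f : α → ℝ} (hf : Continuous f) (hb : BddAbove (f '' s)) {η : ℝ} (hη : 0 < η)
    {y : α} (hy : y ∈ s) :
    ∃ x ∈ s, η * dist x y ≤ f x - f y ∧ ∀ z ∈ s, f z ≤ f x + η * dist z x := by
  -- `S x` collects the points above `x` in Ekeland's order. The iteration repeatedly picks a
  -- near-maximizer of `f` in the current `S x`, with error `(1 / 2) ^ n`.
  let S : α → Set α := fun x => {z ∈ s | η * dist z x ≤ f z - f x}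
  have hS : ∀ x, S x ⊆ s := fun x z hz => hz.1
  have hself : ∀ x ∈ s, x ∈ S x := fun x hx => ⟨hx, by simp⟩
  have htrans : ∀ x z, z ∈ S x → S z ⊆ S x := fun x z hz w hw => ⟨hw.1, by
    have h1 := hz.2
    have h2 := hw.2
    have h3 := mul_le_mul_of_nonneg_left (dist_triangle w z x) hη.le
    linarith⟩
  have hstep : ∀ (n : ℕ) (x : s), ∃ z : s, (z : α) ∈ S x ∧
      ∀ w ∈ S x, f w ≤ f z + (1 / 2) ^ n := fun n x => by
    obtain ⟨z, hz, h⟩ := exists_near_maximizer ⟨_, hself x x.2⟩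
      (hb.mono (Set.image_mono (hS x))) (show (0 : ℝ) < (1 / 2) ^ n by positivity)
    exact ⟨⟨z, hz.1⟩, hz, h⟩
  choose g hg1 hg2 using hstep
  let u : ℕ → s := fun n => Nat.rec ⟨y, hy⟩ (fun n x => g n x) n
  have hu : ∀ n, u (n + 1) = g n (u n) := fun n => rfl
  have hmem : ∀ n m : ℕ, n ≤ m → (u m).1 ∈ S (u n).1 := fun n m h => by
    induction m, h using Nat.le_induction with
    | base => exact hself _ (u n).2
    | succ m _ ih => exact htrans _ _ ih (by rw [hu]; exact hg1 m (u m))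
  have hmono : Monotone fun n => f (u n).1 := monotone_nat_of_le_succ fun n => by
    have h1 := (hmem n (n + 1) n.le_succ).2
    have h2 : 0 ≤ η * dist (u (n + 1)).1 (u n) := by positivity
    linarith
  have hbdd : BddAbove (Set.range fun n => f (u n).1) := hb.mono (by
    rintro _ ⟨n, rfl⟩
    exact ⟨_, (u n).2, rfl⟩)
  have hlim := tendsto_atTop_ciSup hmono hbdd
  have hcauchy : CauchySeq fun n => (u n).1 := by
    rw [Metric.cauchySeq_iff']
    intro ε hε
    obtain ⟨N, hN⟩ := Metric.cauchySeq_iff'.1 hlim.cauchySeq (η * ε) (by positivity)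
    refine ⟨N, fun n hn => ?_⟩
    have h1 := (hmem N n hn).2
    have h2 := lt_of_le_of_lt (le_abs_self _) (hN n hn)
    exact lt_of_mul_lt_mul_left (h1.trans_lt h2) hη.le
  obtain ⟨x, hx⟩ := cauchySeq_tendsto_of_complete hcauchy
  have hxs : x ∈ s := hs.mem_of_tendsto hx (Eventually.of_forall fun n => (u n).2)
  have hfx : Tendsto (fun n => f (u n).1) atTop (𝓝 (f x)) := (hf.tendsto x).comp hx
  have hxS : ∀ n, x ∈ S (u n).1 := fun n => ⟨hxs, by
    refine le_of_tendsto_of_tendsto ((hx.dist tendsto_const_nhds).const_mul η)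
      (hfx.sub_const _) ?_
    filter_upwards [eventually_ge_atTop n] with m hm using (hmem n m hm).2⟩
  refine ⟨x, hxs, (hxS 0).2, fun z hz => ?_⟩
  by_contra! hlt
  -- A better `z` would lie in every `S (u n)`, where `f` exceeds `f (u (n + 1))` by at most `(1 /
  -- 2) ^ n`. In the limit `f z ≤ f x`.
  have hzS : ∀ n, z ∈ S (u n).1 := fun n => htrans _ _ (hxS n) ⟨hz, by linarith⟩
  have hpow : Tendsto (fun n : ℕ => f (u (n + 1)).1 + (1 / 2 : ℝ) ^ n) atTop (𝓝 (f x + 0)) :=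
    ((tendsto_add_atTop_iff_nat 1).2 hfx).add
      (tendsto_pow_atTop_nhds_zero_of_lt_one (by norm_num) (by norm_num))
  have h1 : f z ≤ f x + 0 := ge_of_tendsto' hpow fun n => by
    rw [hu]; exact hg2 n (u n) z (hzS n)
  have h2 : 0 ≤ η * dist z x := by positivity
  linarith

/-- If a functional minus a multiple of the distance to `x` is maximal at `x` over a convex set,
then a small perturbation of the functional is maximal at `x`. -/
theorem exists_dual_le_of_le_norm {E : Type*} [NormedAddCommGroup E] [NormedSpace ℝ E]
    {C : Set E} (hC : Convex ℝ C) {f : StrongDual ℝ E} {x : E} (hx : x ∈ C) {η : ℝ}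
    (hη : 0 ≤ η) (h : ∀ z ∈ C, f (z - x) ≤ η * ‖z - x‖) :
    ∃ g : StrongDual ℝ E, (∀ w, g w ≤ η * ‖w‖) ∧ ∀ z ∈ C, f (z - x) ≤ g (z - x) := by
  -- The strict epigraph of `η‖·‖` is separated from the graph of `f` over `C - x`. The separating
  -- hyperplane passes through the origin and is not vertical; its slope is `g`.
  let A : Set (E × ℝ) := {p | η * ‖p.1‖ < p.2}
  let B : Set (E × ℝ) := (fun z => (z - x, f (z - x))) '' C
  have hA : Convex ℝ A := by
    rintro ⟨p, r⟩ hp ⟨q, s⟩ hq a b ha hb hab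
    simp only [A, Set.mem_ofPred_eq, Prod.smul_mk, Prod.mk_add_mk, smul_eq_mul] at *
    have h1 : ‖a • p + b • q‖ ≤ a * ‖p‖ + b * ‖q‖ := (norm_add_le _ _).trans (by
      rw [norm_smul, norm_smul, Real.norm_of_nonneg ha, Real.norm_of_nonneg hb])
    have h2 := mul_le_mul_of_nonneg_left h1 hη
    rcases ha.eq_or_lt with rfl | ha'
    · have : b = 1 := by linarith
      subst this
      linarith
    · nlinarith [mul_lt_mul_of_pos_left hp ha', mul_le_mul_of_nonneg_left hq.le hb]
  have hAo : IsOpen A := isOpen_lt (by fun_prop) (by fun_prop)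
  have hB : Convex ℝ B := by
    rintro _ ⟨p, hp, rfl⟩ _ ⟨q, hq, rfl⟩ a b ha hb hab
    refine ⟨a • p + b • q, hC hp hq ha hb hab, ?_⟩
    have : a • p + b • q - x = a • (p - x) + b • (q - x) := by
      rw [smul_sub, smul_sub, sub_add_sub_comm, ← add_smul, hab, one_smul]
    simp [this]
  have hdisj : Disjoint A B := by
    rw [Set.disjoint_left]
    rintro _ hp ⟨z, hz, rfl⟩
    exact absurd (h z hz) (not_le.2 hp)
  obtain ⟨φ, u, hφA, hφB⟩ := geometric_hahn_banach_open hA hAo hB hdisj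
  have hφ : ∀ w r, φ (w, r) = φ (w, 0) + r * φ (0, 1) := fun w r => by
    rw [← smul_eq_mul, ← map_smul, ← map_add]; simp
  have hu0 : u ≤ 0 := by
    have := hφB (0, 0) ⟨x, hx, by simp⟩
    rwa [show ((0, 0) : E × ℝ) = 0 from rfl, map_zero] at this
  have hu : u = 0 := by
    refine le_antisymm hu0 ?_
    by_contra! hlt
    have hpos : ∀ r : ℝ, 0 < r → r * φ (0, 1) < u := fun r hr => by
      have := hφA (0, r) (by simpa [A] using hr)
      rwa [hφ, show ((0, 0) : E × ℝ) = 0 from rfl, map_zero, zero_add] at this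
    have h1 := hpos 1 one_pos
    -- The height at which `φ (0, ·)` equals `u / 2`, which is not below a negative `u`.
    have h2 := hpos (u / (2 * φ (0, 1))) (div_pos_of_neg_of_neg hlt (by linarith))
    have h3 : φ (0, 1) ≠ 0 := by linarith
    have h4 : u / (2 * φ (0, 1)) * φ (0, 1) = u / 2 := by field_simp
    linarith
  subst hu
  have hρ : φ (0, 1) < 0 := hφA (0, 1) (by simp [A])
  set ρ := φ (0, 1)
  refine ⟨(-ρ)⁻¹ • φ.comp (ContinuousLinearMap.inl ℝ E ℝ), fun w => ?_, fun z hz => ?_⟩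
  · have h1 : ∀ r, η * ‖w‖ < r → φ (w, 0) ≤ r * (-ρ) := fun r hr => by
      have := hφA (w, r) hr
      rw [hφ] at this
      linarith
    have h2 : φ (w, 0) ≤ (η * ‖w‖) * (-ρ) := by
      refine le_of_forall_pos_le_add fun ε hε => ?_
      have h3 := h1 (η * ‖w‖ + ε / (-ρ)) (by
        have : 0 < ε / (-ρ) := div_pos hε (by linarith)
        linarith)
      have h4 : ε / (-ρ) * (-ρ) = ε := div_mul_cancel₀ _ (by linarith)
      linarith
    have : (-ρ)⁻¹ * φ (w, 0) ≤ η * ‖w‖ := by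
      rw [inv_mul_le_iff₀ (by linarith)]; linarith
    simpa using this
  · have h1 := hφB _ ⟨z, hz, rfl⟩
    simp only at h1
    rw [hφ] at h1
    have : f (z - x) ≤ (-ρ)⁻¹ * φ (z - x, 0) := by
      rw [le_inv_mul_iff₀ (by linarith)]; linarith
    simpa using this

/-! ### Bishop-Phelps-Bollobás, the RNP and strongly exposed points -/

section

variable {𝕜 : Type*} [RCLike 𝕜] {E : Type*} [NormedAddCommGroup E] [NormedSpace 𝕜 E]

lemma re_apply_le_norm (f : StrongDual 𝕜 E) {x : E} (hx : x ∈ Metric.closedBall (0 : E) 1) :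
    RCLike.re (f x) ≤ ‖f‖ :=
  (RCLike.re_le_norm _).trans (f.unit_le_opNorm x (mem_closedBall_zero_iff.1 hx))

lemma exists_re_apply_gt (f : StrongDual 𝕜 E) {δ : ℝ} (hδ : 0 < δ) :
    ∃ x ∈ Metric.closedBall (0 : E) 1, ‖f‖ - δ < RCLike.re (f x) := by
  rcases (norm_nonneg f).eq_or_lt with h0 | h0
  · exact ⟨0, by simp, by simp [← h0, hδ]⟩
  obtain ⟨x, hx, hlt⟩ := f.exists_lt_apply_of_lt_opNorm (sub_lt_self ‖f‖ hδ)
  obtain ⟨c, hc, hcx⟩ := RCLike.exists_norm_eq_mul_self (f x)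
  refine ⟨c • x, by simpa [norm_smul, hc] using hx.le, ?_⟩
  rwa [map_smul, smul_eq_mul, ← hcx, RCLike.ofReal_re]

/-- A functional whose real part attains its supremum over the unit ball at `x` attains its norm
there. -/
lemma re_apply_eq_norm (f : StrongDual 𝕜 E) {x : E} (hx : x ∈ Metric.closedBall (0 : E) 1)
    (h : ∀ z ∈ Metric.closedBall (0 : E) 1, RCLike.re (f z) ≤ RCLike.re (f x)) :
    RCLike.re (f x) = ‖f‖ := by
  refine le_antisymm (re_apply_le_norm f hx) (le_of_forall_pos_le_add fun δ hδ => ?_)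
  obtain ⟨z, hz, hlt⟩ := exists_re_apply_gt f hδ
  linarith [h z hz]

/-- The Bishop-Phelps-Bollobás theorem for the unit ball, keeping the space fixed. -/
theorem bishop_phelps_bollobas [CompleteSpace E] (f : StrongDual 𝕜 E) {y : E}
    (hy : y ∈ Metric.closedBall (0 : E) 1) {η : ℝ} (hη : 0 < η)
    (hfy : ‖f‖ - η ^ 2 < RCLike.re (f y)) :
    ∃ x ∈ Metric.closedBall (0 : E) 1, ∃ h : StrongDual 𝕜 E,
      dist x y ≤ η ∧ ‖f - h‖ ≤ η ∧ RCLike.re (h x) = ‖h‖ := by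
  let : NormedSpace ℝ E := NormedSpace.restrictScalars ℝ 𝕜 E
  have : IsScalarTower ℝ 𝕜 E := RestrictScalars.isScalarTower ℝ 𝕜 E
  let fr : StrongDual ℝ E := RCLike.reCLM.comp (f.restrictScalars ℝ)
  have hfr : ∀ z, fr z = RCLike.re (f z) := fun z => rfl
  -- With slope `η`, the gain `f x - f y < η ^ 2` forces `dist x y ≤ η`. Subtracting the functional
  -- `g` found below makes `x` a maximizer.
  obtain ⟨x, hx, h1, h2⟩ := ekeland (s := Metric.closedBall (0 : E) 1) Metric.isClosed_closedBall
    fr.continuous ⟨‖f‖, by rintro _ ⟨z, hz, rfl⟩; exact re_apply_le_norm f hz⟩ hη hy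
  obtain ⟨g, hg1, hg2⟩ := exists_dual_le_of_le_norm (convex_closedBall (0 : E) 1) hx hη.le
    (f := fr) fun z hz => by
      rw [map_sub, ← dist_eq_norm]; linarith [h2 z hz]
  have hgn : ‖g‖ ≤ η := g.opNorm_le_bound hη.le fun w => by
    rw [Real.norm_eq_abs, abs_le]
    have := hg1 (-w)
    rw [map_neg, norm_neg] at this
    exact ⟨by linarith, hg1 w⟩
  refine ⟨x, hx, f - g.extendRCLike, ?_, ?_, ?_⟩
  · rw [hfr, hfr] at h1
    have h3 := re_apply_le_norm f hx
    nlinarith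
  · rw [sub_sub_cancel, StrongDual.norm_extendRCLike]
    exact hgn
  · refine re_apply_eq_norm _ hx fun z hz => ?_
    have h3 := hg2 z hz
    rw [map_sub, map_sub, hfr, hfr] at h3
    simp only [sub_apply, map_sub, StrongDual.re_extendRCLike_apply]
    linarith

variable (𝕜 E) in
/-- The functionals having a slice of the unit ball contained in a ball of radius `ε`. -/
def smallSlice (ε : ℝ) : Set (StrongDual 𝕜 E) :=
  {f | ∃ η > 0, ∃ c : E, ∀ x ∈ Metric.closedBall (0 : E) 1,
    ‖f‖ - η < RCLike.re (f x) → dist x c < ε}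

lemma isOpen_smallSlice (ε : ℝ) : IsOpen (smallSlice 𝕜 E ε) := by
  rw [Metric.isOpen_iff]
  rintro f ⟨η, hη, c, h⟩
  refine ⟨η / 3, by positivity, fun g hg => ⟨η / 3, by positivity, c, fun x hx hgx => h x hx ?_⟩⟩
  rw [mem_ball_iff_norm] at hg
  have h1 := re_apply_le_norm (g - f) hx
  have h2 := norm_sub_norm_le f g
  rw [norm_sub_rev] at h2
  simp only [sub_apply, map_sub] at h1
  linarith

/-- Let `A` be the set of points of the ball at which some functional in the open set `V` attains
its norm. Dentability gives a small slice of `A` cut by some `g`, containing a point `x` supported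
by some `f ∈ V`. For small `t > 0`, thin slices of the ball by `f + t g ∈ V` force `g` to be almost
as large as at `x`. By Bishop-Phelps-Bollobás their points are close to the small slice of `A`, so
they have small diameter too. -/
lemma dense_smallSlice [CompleteSpace E] (hE : HasRNP 𝕜 E) {ε : ℝ} (hε : 0 < ε) :
    Dense (smallSlice 𝕜 E ε) := by
  rw [dense_iff_inter_open]
  intro V hV hVne
  by_contra hempty
  have hbad : ∀ f ∈ V, ∀ η > 0, ∀ c : E, ∃ x ∈ Metric.closedBall (0 : E) 1,
      ‖f‖ - η < RCLike.re (f x) ∧ ε ≤ dist x c := fun f hf η hη c => by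
    by_contra! hcon
    exact hempty ⟨f, hf, η, hη, c, hcon⟩
  let A : Set E := {x ∈ Metric.closedBall (0 : E) 1 | ∃ f ∈ V, RCLike.re (f x) = ‖f‖}
  have hbpb : ∀ f ∈ V, ∃ r > 0, ∀ η > 0, η < r → ∀ y ∈ Metric.closedBall (0 : E) 1,
      ‖f‖ - η ^ 2 < RCLike.re (f y) → ∃ x ∈ A, dist x y ≤ η := fun f hf => by
    obtain ⟨r, hr, hball⟩ := Metric.isOpen_iff.1 hV f hf
    refine ⟨r, hr, fun η hη hηr y hy hfy => ?_⟩
    obtain ⟨x, hx, h, hxy, hfh, hhx⟩ := bishop_phelps_bollobas f hy hη hfy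
    refine ⟨x, ⟨hx, h, hball ?_, hhx⟩, hxy⟩
    rw [mem_ball_iff_norm, norm_sub_rev]
    exact hfh.trans_lt hηr
  have hAne : A.Nonempty := by
    obtain ⟨f, hf⟩ := hVne
    obtain ⟨r, hr, h⟩ := hbpb f hf
    obtain ⟨y, hy, hfy⟩ := exists_re_apply_gt f (show 0 < (r / 2) ^ 2 by positivity)
    obtain ⟨x, hx, -⟩ := h (r / 2) (by positivity) (by linarith) y hy hfy
    exact ⟨x, hx⟩
  have hAb : Bornology.IsBounded A := Metric.isBounded_closedBall.subset fun x hx => hx.1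
  obtain ⟨g, c, ⟨x, ⟨hx, f, hf, hfx⟩, hgx⟩, hdiam⟩ := hE A hAne hAb (ε / 2) (by positivity)
  set s := (RCLike.re (g x) - c) / 2 with hs
  have hspos : 0 < s := by linarith
  obtain ⟨t, ht, hft⟩ : ∃ t : ℝ, 0 < t ∧ f + (t : 𝕜) • g ∈ V := by
    have hcont : Continuous fun t : ℝ => f + (t : 𝕜) • g := by fun_prop
    have h0 : f + ((0 : ℝ) : 𝕜) • g = f := by ext z; simp
    have hmem : ∀ᶠ t : ℝ in 𝓝 0, f + (t : 𝕜) • g ∈ V :=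
      (hcont.tendsto 0).eventually (hV.mem_nhds (h0.symm ▸ hf))
    have hmem' : ∀ᶠ t : ℝ in 𝓝[>] 0, f + (t : 𝕜) • g ∈ V := hmem.filter_mono nhdsWithin_le_nhds
    obtain ⟨t, ht, h⟩ := (eventually_mem_nhdsWithin.and hmem').exists
    exact ⟨t, ht, h⟩
  obtain ⟨r, hr, hsup⟩ := hbpb _ hft
  -- As `re (f y) ≤ ‖f‖ = re (f x)`, any loss of less than `t * s` in `f + t g` bounds the loss in
  -- `g` by `s`.
  have hslice : ∀ y ∈ Metric.closedBall (0 : E) 1,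
      ‖f + (t : 𝕜) • g‖ - t * s < RCLike.re ((f + (t : 𝕜) • g) y) → c + s < RCLike.re (g y) := by
    intro y hy h
    have h1 := re_apply_le_norm (f + (t : 𝕜) • g) hx
    have h2 := re_apply_le_norm f hy
    simp only [add_apply, smul_apply, smul_eq_mul, map_add,
      RCLike.re_ofReal_mul] at h h1
    have h3 : t * (RCLike.re (g x) - s) < t * RCLike.re (g y) := by linarith
    have h4 := lt_of_mul_lt_mul_left h3 ht.le
    linarith
  obtain ⟨η, ⟨hη1, hη2, hη3, hη4⟩, hη⟩ : ∃ η : ℝ,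
      (η < r ∧ η ^ 2 < t * s ∧ ‖g‖ * η < s ∧ η < ε / 4) ∧ 0 < η := by
    have h : ∀ᶠ η in 𝓝 (0 : ℝ), η < r ∧ η ^ 2 < t * s ∧ ‖g‖ * η < s ∧ η < ε / 4 := by
      refine (eventually_lt_nhds hr).and (((?_ : ContinuousAt (fun η : ℝ => η ^ 2) 0).eventually
        (gt_mem_nhds (by simpa using mul_pos ht hspos))).and
        (((?_ : ContinuousAt (fun η : ℝ => ‖g‖ * η) 0).eventually
        (gt_mem_nhds (by simpa using hspos))).and (eventually_lt_nhds (by positivity))))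
      · fun_prop
      · fun_prop
    have h' := h.filter_mono (nhdsWithin_le_nhds (s := Set.Ioi 0))
    exact (h'.and eventually_mem_nhdsWithin).exists
  have hnear : ∀ y ∈ Metric.closedBall (0 : E) 1,
      ‖f + (t : 𝕜) • g‖ - η ^ 2 < RCLike.re ((f + (t : 𝕜) • g) y) →
      ∃ x' ∈ {x ∈ A | c < RCLike.re (g x)}, dist x' y ≤ η := by
    intro y hy h
    obtain ⟨x', hx', hd⟩ := hsup η hη hη1 y hy h
    refine ⟨x', ⟨hx', ?_⟩, hd⟩
    have h1 := hslice y hy (by linarith)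
    have h2 : RCLike.re (g (y - x')) ≤ ‖g‖ * η := (RCLike.re_le_norm _).trans
      ((g.le_opNorm _).trans (mul_le_mul_of_nonneg_left (by
        rwa [← dist_eq_norm, dist_comm]) (norm_nonneg g)))
    rw [map_sub, map_sub] at h2
    linarith
  obtain ⟨y₁, hy₁, hfy₁⟩ := exists_re_apply_gt (f + (t : 𝕜) • g) (show 0 < η ^ 2 by positivity)
  obtain ⟨x₁, hx₁, hd₁⟩ := hnear y₁ hy₁ hfy₁
  obtain ⟨y₂, hy₂, hfy₂, hd⟩ := hbad _ hft (η ^ 2) (by positivity) y₁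
  obtain ⟨x₂, hx₂, hd₂⟩ := hnear y₂ hy₂ hfy₂
  -- Boundedness matters here: `Metric.diam` is `0` on unbounded sets.
  have h1 := Metric.dist_le_diam_of_mem (hAb.subset (Set.sep_subset _ _)) hx₂ hx₁
  have h2 := dist_triangle4 y₂ x₂ x₁ y₁
  rw [dist_comm y₂ x₂] at h2
  linarith

/-- A functional with slices of the unit ball of arbitrarily small diameter is strongly
exposing. -/
lemma mem_SE_of_forall_mem_smallSlice [CompleteSpace E] {f : StrongDual 𝕜 E}
    (hf : ∀ n : ℕ, f ∈ smallSlice 𝕜 E (1 / (n + 1))) : f ∈ SE 𝕜 E := by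
  have hsmall : ∀ ε > 0, ∃ η > 0, ∀ x ∈ Metric.closedBall (0 : E) 1,
      ∀ y ∈ Metric.closedBall (0 : E) 1, ‖f‖ - η < RCLike.re (f x) →
      ‖f‖ - η < RCLike.re (f y) → dist x y < ε := by
    intro ε hε
    obtain ⟨k, hk⟩ := exists_nat_one_div_lt (show 0 < ε / 2 by positivity)
    obtain ⟨η, hη, c, h⟩ := hf k
    refine ⟨η, hη, fun x hx y hy hfx hfy => ?_⟩
    linarith [dist_triangle_right x y c, h x hx hfx, h y hy hfy]
  have hmax : ∀ n : ℕ, ∃ x ∈ Metric.closedBall (0 : E) 1,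
      ‖f‖ - 1 / (n + 1 : ℝ) < RCLike.re (f x) := fun n =>
    exists_re_apply_gt f (by positivity)
  choose x hx hfx using hmax
  have hxlim : Tendsto (fun n => RCLike.re (f (x n))) atTop (𝓝 ‖f‖) := by
    refine tendsto_of_tendsto_of_tendsto_of_le_of_le (g := fun n : ℕ => ‖f‖ - 1 / (n + 1 : ℝ)) ?_
      tendsto_const_nhds (fun n => (hfx n).le) (fun n => re_apply_le_norm f (hx n))
    simpa using (tendsto_one_div_add_atTop_nhds_zero_nat (𝕜 := ℝ)).const_sub ‖f‖
  obtain ⟨x₀, hx₀⟩ := cauchySeq_tendsto_of_complete (u := x) (by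
    rw [Metric.cauchySeq_iff]
    intro ε hε
    obtain ⟨η, hη, h⟩ := hsmall ε hε
    obtain ⟨N, hN⟩ := eventually_atTop.1 (hxlim.eventually (lt_mem_nhds (sub_lt_self ‖f‖ hη)))
    exact ⟨N, fun m hm n hn => h _ (hx m) _ (hx n) (hN m hm) (hN n hn)⟩)
  have hx₀B : x₀ ∈ Metric.closedBall (0 : E) 1 :=
    Metric.isClosed_closedBall.mem_of_tendsto hx₀ (Eventually.of_forall hx)
  have hfx₀ : RCLike.re (f x₀) = ‖f‖ := tendsto_nhds_unique
    (((RCLike.continuous_re.comp f.continuous).tendsto x₀).comp hx₀) hxlim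
  refine ⟨x₀, hx₀B, fun z hz => hfx₀ ▸ re_apply_le_norm f hz, fun z hz hlim => ?_⟩
  rw [hfx₀] at hlim
  rw [Metric.tendsto_nhds]
  intro ε hε
  obtain ⟨η, hη, h⟩ := hsmall ε hε
  filter_upwards [hlim.eventually (lt_mem_nhds (sub_lt_self ‖f‖ hη))] with n hn
  exact h _ (hz n) _ hx₀B hn (by linarith)

/-- In a space with the Radon-Nikodým property the strongly exposing functionals are dense. -/
theorem dense_SE_of_hasRNP [CompleteSpace E] (hE : HasRNP 𝕜 E) : Dense (SE 𝕜 E) :=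
  (dense_iInter_of_isOpen (f := fun n : ℕ => smallSlice 𝕜 E (1 / (n + 1)))
    (fun _ => isOpen_smallSlice _) fun n => dense_smallSlice hE (by positivity)).mono
    fun _ hf => mem_SE_of_forall_mem_smallSlice (Set.mem_iInter.1 hf)

/-- A subset of the rotations of a countable set is countable up to rotations. -/
lemma CountableUpToRotations.of_subset {A D : Set E} (hD : D.Countable)
    (h : ∀ a ∈ A, ∃ d ∈ D, ∃ θ : 𝕜, ‖θ‖ = 1 ∧ a = θ • d) : CountableUpToRotations 𝕜 A := by
  choose! d hd θ hθ had using h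
  -- The definition asks for representatives in `A` itself, so one preimage is chosen for each value
  -- of `d` on `A`.
  have hcount : (d '' A).Countable := hD.mono (by rintro _ ⟨a, ha, rfl⟩; exact hd a ha)
  obtain ⟨C, hCA, hC⟩ := Set.SurjOn.exists_bijOn_subset (Set.surjOn_image d A)
  refine ⟨C, hCA, ?_, fun a ha => ?_⟩
  · exact Set.countable_of_injective_of_countable_image hC.injOn (hC.image_eq ▸ hcount)
  · obtain ⟨c, hc, hca⟩ := hC.surjOn ⟨a, ha, rfl⟩
    refine ⟨c, hc, θ a * (θ c)⁻¹, by simp [hθ a ha, hθ c (hCA hc)], ?_⟩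
    have h0 : θ c ≠ 0 := norm_ne_zero_iff.1 (by rw [hθ c (hCA hc)]; exact one_ne_zero)
    have h1 : (θ c)⁻¹ • c = d c := by
      rw [inv_smul_eq_iff₀ h0]; exact had c (hCA hc)
    rw [mul_smul, h1, hca]
    exact had a ha

/-- A space with the Radon-Nikodým property whose unit ball has countably many strongly exposed
points up to rotations is separable. -/
theorem separableSpace_of_countableUpToRotations_strExp [CompleteSpace E] (hE : HasRNP 𝕜 E)
    (hC : CountableUpToRotations 𝕜 (strExp 𝕜 (Metric.closedBall (0 : E) 1))) :
    TopologicalSpace.SeparableSpace E := by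
  obtain ⟨C, -, hC, hrot⟩ := hC
  let W : Submodule 𝕜 E := (Submodule.span 𝕜 C).topologicalClosure
  have hW : strExp 𝕜 (Metric.closedBall (0 : E) 1) ⊆ W := fun a ha => by
    obtain ⟨c, hc, θ, -, rfl⟩ := hrot a ha
    exact W.smul_mem θ (Submodule.le_topologicalClosure _ (Submodule.subset_span hc))
  have htop : W = ⊤ := by
    by_contra hne
    obtain ⟨v, hv⟩ : ∃ v, v ∉ W := by
      by_contra! h
      exact hne (Submodule.eq_top_iff'.2 h)
    have : IsClosed (W : Set E) := Submodule.isClosed_topologicalClosure _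
    obtain ⟨φ, hφ, hφv⟩ := exists_dual_vector 𝕜 (W.mkQ v) (by simpa using hv)
    let f : StrongDual 𝕜 E := φ.comp (W.mkQL)
    have hfW : ∀ w ∈ W, f w = 0 := fun w hw => by
      have : W.mkQ w = 0 := by simpa using hw
      change φ (W.mkQ w) = 0
      rw [this, map_zero]
    have hf : f ≠ 0 := fun h0 => by
      have h1 : φ (W.mkQ v) = 0 := DFunLike.congr_fun h0 v
      rw [hφv] at h1
      exact hv (by simpa using h1)
    -- The point `x₀` exposed by `g` lies in `W`, where `f` vanishes. Hence `‖g‖ = re ((g - f) x₀) <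
    -- ‖f‖ / 2`, which is too small for a functional this close to `f`.
    obtain ⟨g, ⟨x₀, hx₀, hmax, hexp⟩, hdist⟩ := (dense_SE_of_hasRNP hE).exists_dist_lt f
      (show 0 < ‖f‖ / 2 by positivity)
    have h1 := re_apply_eq_norm g hx₀ hmax
    have h2 := re_apply_le_norm (g - f) hx₀
    have h3 : f x₀ = 0 := hfW x₀ (hW ⟨g, hx₀, hmax, hexp⟩)
    rw [dist_eq_norm, norm_sub_rev] at hdist
    simp only [sub_apply, map_sub, h3, map_zero] at h2
    have h4 := norm_sub_norm_le f g
    rw [norm_sub_rev] at h4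
    linarith
  have hsep : TopologicalSpace.IsSeparable (W : Set E) :=
    (hC.isSeparable.span (R := 𝕜)).closure
  rw [htop] at hsep
  exact TopologicalSpace.isSeparable_univ_iff.1 hsep

end

/-! ### Stegall's variational principle in separable duals -/

section

variable {𝕜 : Type*} [RCLike 𝕜] {Y : Type*} [NormedAddCommGroup Y] [NormedSpace 𝕜 Y]

/-- The conjugate function of `-φ`, restricted to `C`, at a point of the predual. -/
noncomputable def conjSup (C : Set (StrongDual 𝕜 Y)) (φ : StrongDual 𝕜 Y → ℝ) (y : Y) : ℝ :=
  sSup ((fun m : StrongDual 𝕜 Y => φ m + RCLike.re (m y)) '' C)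

variable {C : Set (StrongDual 𝕜 Y)} {φ : StrongDual 𝕜 Y → ℝ}

lemma bddAbove_image_add_re (hC : Bornology.IsBounded C) (hφ : BddAbove (φ '' C)) (y : Y) :
    BddAbove ((fun m : StrongDual 𝕜 Y => φ m + RCLike.re (m y)) '' C) := by
  obtain ⟨R, hR⟩ := hC.exists_norm_le
  obtain ⟨b, hb⟩ := hφ
  refine ⟨b + R * ‖y‖, ?_⟩
  rintro _ ⟨m, hm, rfl⟩
  exact add_le_add (hb ⟨m, hm, rfl⟩) ((RCLike.re_le_norm _).trans (m.le_of_opNorm_le (hR m hm) y))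

lemma le_conjSup (hC : Bornology.IsBounded C) (hφ : BddAbove (φ '' C)) (y : Y)
    {m : StrongDual 𝕜 Y} (hm : m ∈ C) : φ m + RCLike.re (m y) ≤ conjSup C φ y :=
  le_csSup (bddAbove_image_add_re hC hφ y) ⟨m, hm, rfl⟩

lemma exists_conjSup_lt (hC : C.Nonempty) (y : Y) {δ : ℝ} (hδ : 0 < δ) :
    ∃ m ∈ C, conjSup C φ y - δ < φ m + RCLike.re (m y) := by
  obtain ⟨_, ⟨m, hm, rfl⟩, h⟩ := exists_lt_of_lt_csSup
    (hC.image fun m : StrongDual 𝕜 Y => φ m + RCLike.re (m y)) (sub_lt_self (conjSup C φ y) hδ)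
  exact ⟨m, hm, h⟩

/-- Near-maximizers at `y` are approximate subgradients at `y`. -/
lemma conjSup_sub_le (hC : Bornology.IsBounded C) (hφ : BddAbove (φ '' C)) {y : Y} (z : Y)
    {m : StrongDual 𝕜 Y} (hm : m ∈ C) {δ : ℝ} (h : conjSup C φ y - δ < φ m + RCLike.re (m y)) :
    conjSup C φ y - δ + RCLike.re (m (z - y)) ≤ conjSup C φ z := by
  have := le_conjSup hC hφ z hm
  rw [map_sub, map_sub]
  linarith

/-- Existence of subgradients. -/
lemma exists_subgradient (hne : C.Nonempty) (hC : Bornology.IsBounded C)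
    (hφ : BddAbove (φ '' C)) (y : Y) :
    ∃ g : StrongDual 𝕜 Y, ∀ z, conjSup C φ y + RCLike.re (g (z - y)) ≤ conjSup C φ z := by
  obtain ⟨R, hR⟩ := hC.exists_norm_le
  have hmax : ∀ n : ℕ, ∃ m ∈ C, conjSup C φ y - 1 / (n + 1 : ℝ) < φ m + RCLike.re (m y) :=
    fun n => exists_conjSup_lt hne y (by positivity)
  choose m hm hlt using hmax
  -- A weak* limit of near-maximizers along an ultrafilter is a subgradient, even though the
  -- supremum over `C` need not be attained.
  let u : Ultrafilter ℕ := hyperfilter ℕ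
  let w : ℕ → WeakDual 𝕜 Y := fun n => StrongDual.toWeakDual (m n)
  have hcompact := WeakDual.isCompact_closedBall (𝕜 := 𝕜) (0 : StrongDual 𝕜 Y) R
  obtain ⟨g, -, hg⟩ := hcompact.ultrafilter_le_nhds (u.map w) (by
      rw [Ultrafilter.coe_map]
      exact tendsto_principal.2 (Eventually.of_forall fun n => by
        simpa [w] using hR _ (hm n)))
  refine ⟨WeakDual.toStrongDual g, fun z => ?_⟩
  have hu : (u : Filter ℕ) ≤ atTop := Nat.hyperfilter_le_atTop
  have h1 : Tendsto (fun n => RCLike.re (m n (z - y))) u (𝓝 (RCLike.re (g (z - y)))) :=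
    ((RCLike.continuous_re.comp (WeakDual.eval_continuous (z - y))).tendsto g).comp hg
  have h2 : Tendsto (fun n : ℕ => conjSup C φ y - 1 / (n + 1 : ℝ)) u (𝓝 (conjSup C φ y - 0)) :=
    (tendsto_const_nhds.sub (tendsto_one_div_add_atTop_nhds_zero_nat (𝕜 := ℝ))).mono_left hu
  rw [sub_zero] at h2
  exact le_of_tendsto' (h2.add h1) fun n => conjSup_sub_le hC hφ z (hm n) (hlt n)

/-- Stegall's variational principle in a separable dual space, with perturbations from the
predual. -/
theorem stegall_of_separable_dual [CompleteSpace Y]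
    [TopologicalSpace.SeparableSpace (StrongDual 𝕜 Y)]
    (hne : C.Nonempty) (hC : Bornology.IsBounded C) (hφ : BddAbove (φ '' C))
    {V : Set Y} (hV : IsOpen V) (hVne : V.Nonempty) {ε : ℝ} (hε : 0 < ε) :
    ∃ y ∈ V, ∃ η > 0, ∃ c : StrongDual 𝕜 Y, ∀ m ∈ C,
      conjSup C φ y - η < φ m + RCLike.re (m y) → dist m c ≤ ε := by
  set δ := ε / 2 with hδ
  have hδpos : 0 < δ := by positivity
  choose g hg using exists_subgradient hne hC hφ
  let d : ℕ → StrongDual 𝕜 Y := TopologicalSpace.denseSeq _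
  -- Separability of the dual covers `Y` by countably many sets on which the chosen subgradient
  -- varies little; Baire makes one closure have interior inside `V`.
  let K : ℕ → Set Y := fun n => closure {y | dist (g y) (d n) < δ}
  have hcover : (Set.univ : Set Y) ⊆ ⋃ n, K n := fun y _ => by
    obtain ⟨n, hn⟩ :=
      (TopologicalSpace.denseRange_denseSeq (StrongDual 𝕜 Y)).exists_dist_lt (g y) hδpos
    exact Set.mem_iUnion.2 ⟨n, subset_closure hn⟩
  have hdense := dense_iUnion_interior_of_closed (f := K) (fun _ => isClosed_closure)
    (Set.univ_subset_iff.1 hcover)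
  obtain ⟨y, hyV, hyK⟩ := hdense.inter_open_nonempty V hV hVne
  obtain ⟨n, hn⟩ := Set.mem_iUnion.1 hyK
  obtain ⟨r, hr, hball⟩ := Metric.isOpen_iff.1 isOpen_interior y hn
  refine ⟨y, hyV, r * δ / 8, by positivity, d n, fun m hm hlt => ?_⟩
  by_contra! hfar
  obtain ⟨R, hR⟩ := hC.exists_norm_le
  have hfar' : ε < ‖m - d n‖ := by rwa [← dist_eq_norm]
  obtain ⟨v, hv, hmv⟩ := exists_re_apply_gt (m - d n) (show 0 < ‖m - d n‖ - ε by linarith)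
  rw [mem_closedBall_zero_iff] at hv
  rw [sub_sub_cancel] at hmv
  set t := r / 2 with ht
  have htpos : 0 < t := by positivity
  have hyt : y + (t : 𝕜) • v ∈ K n := by
    refine interior_subset (hball ?_)
    rw [mem_ball_iff_norm, add_sub_cancel_left, norm_smul, RCLike.norm_ofReal, abs_of_pos htpos]
    nlinarith
  obtain ⟨e, he, heD⟩ : ∃ e > 0, e * (2 * ‖m - d n‖ + δ) ≤ r * δ / 8 := by
    refine ⟨r * δ / 8 / (2 * ‖m - d n‖ + δ), by positivity, ?_⟩
    rw [div_mul_cancel₀ _ (by positivity)]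
  obtain ⟨y', hy', hdist⟩ := Metric.mem_closure_iff.1 hyt e he
  -- Monotonicity of approximate subgradients: `re ((g y' - m) (y' - y)) ≥ -(r * δ / 8)`. Along `t •
  -- v` the same quantity is at most `t * (δ - ε) = -(r * δ / 2)`, and the choice of `e` keeps the
  -- remainder below `r * δ / 8`.
  have h1 := hg y' y
  have h2 := conjSup_sub_le hC hφ y' hm hlt
  have h3 : -(r * δ / 8) ≤ RCLike.re ((g y' - m) (y' - y)) := by
    have : RCLike.re (g y' (y - y')) = - RCLike.re (g y' (y' - y)) := by
      rw [← neg_sub, map_neg, map_neg]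
    rw [sub_apply, map_sub]
    linarith
  rw [Set.mem_ofPred_eq, dist_eq_norm] at hy'
  rw [dist_eq_norm, norm_sub_rev] at hdist
  set w := y' - (y + (t : 𝕜) • v) with hw
  have h4 : y' - y = (t : 𝕜) • v + w := by rw [hw]; abel
  have h5 : RCLike.re ((g y' - m) (y' - y)) =
      t * RCLike.re ((g y' - d n) v) - t * RCLike.re ((m - d n) v)
        + RCLike.re ((g y' - d n) w) - RCLike.re ((m - d n) w) := by
    rw [h4, show g y' - m = (g y' - d n) - (m - d n) by abel]
    simp only [sub_apply, map_add, map_smul, smul_eq_mul, map_sub, RCLike.re_ofReal_mul]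
    ring
  have h6 : RCLike.re ((g y' - d n) v) ≤ δ :=
    (re_apply_le_norm _ (mem_closedBall_zero_iff.2 hv)).trans hy'.le
  have h7 : RCLike.re ((g y' - d n) w) ≤ δ * e := (RCLike.re_le_norm _).trans
    (((g y' - d n).le_of_opNorm_le hy'.le w).trans (by gcongr))
  have h8 : -RCLike.re ((m - d n) w) ≤ ‖m - d n‖ * e := by
    have : |RCLike.re ((m - d n) w)| ≤ ‖m - d n‖ * e := (RCLike.abs_re_le_norm _).trans
      (((m - d n).le_opNorm w).trans (by gcongr))
    linarith [neg_le_abs (RCLike.re ((m - d n) w))]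
  have h9 : t * RCLike.re ((g y' - d n) v) ≤ t * δ := by gcongr
  have h10 : t * ε ≤ t * RCLike.re ((m - d n) v) := by gcongr
  have h11 : 0 ≤ e * ‖m - d n‖ := by positivity
  have h12 : 0 < r * δ := by positivity
  have h13 : t * ε = r * δ := by rw [ht, hδ]; ring
  have h14 : t * δ = r * δ / 2 := by rw [ht]; ring
  nlinarith

/-- A separable dual space has the Radon-Nikodým property. -/
theorem hasRNP_of_separable_dual [CompleteSpace Y]
    [TopologicalSpace.SeparableSpace (StrongDual 𝕜 Y)] : HasRNP 𝕜 (StrongDual 𝕜 Y) := by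
  intro C hne hC ε hε
  have hφ : BddAbove ((fun _ : StrongDual 𝕜 Y => (0 : ℝ)) '' C) :=
    ⟨0, by rintro _ ⟨_, _, rfl⟩; exact le_rfl⟩
  -- With `φ = 0` the near-maximizers form a slice of `C` cut by evaluation at `y`.
  obtain ⟨y, -, η, hη, c, h⟩ := stegall_of_separable_dual hne hC hφ isOpen_univ
    Set.univ_nonempty (show 0 < ε / 4 by positivity)
  refine ⟨ContinuousLinearMap.apply 𝕜 𝕜 y, conjSup C (fun _ => 0) y - η, ?_, ?_⟩
  · obtain ⟨m, hm, hlt⟩ := exists_conjSup_lt (φ := fun _ => 0) hne y hη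
    exact ⟨m, hm, by simpa using hlt⟩
  · refine (Metric.diam_le_of_forall_dist_le (C := ε / 2) (by positivity) ?_).trans_lt
      (by linarith)
    rintro a ⟨ha, ha'⟩ b ⟨hb, hb'⟩
    have h1 := h a ha (by simpa using ha')
    have h2 := h b hb (by simpa using hb')
    linarith [dist_triangle_right a b c]

end

/-! ### Operators whose almost maximizing functionals cluster -/

section

variable {𝕜 : Type*} [RCLike 𝕜] {X : Type*} [NormedAddCommGroup X] [NormedSpace 𝕜 X]
  {Y : Type*} [NormedAddCommGroup Y] [NormedSpace 𝕜 Y]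

variable (𝕜 X Y) in
/-- The operators `T` such that the functionals `m` in the unit ball of the dual at which
`‖m ∘ T‖` is almost maximal are, up to rotation, within distance `ε` of a single functional. -/
def smallMaximizers (ε : ℝ) : Set (X →L[𝕜] Y) :=
  {T | ∃ η > 0, ∃ c : StrongDual 𝕜 Y, ∀ m ∈ Metric.closedBall (0 : StrongDual 𝕜 Y) 1,
    ‖T‖ - η < ‖m.comp T‖ → ∃ θ : 𝕜, ‖θ‖ = 1 ∧ dist (θ • m) c ≤ ε}

lemma norm_comp_le_of_mem_closedBall (T : X →L[𝕜] Y) {m : StrongDual 𝕜 Y}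
    (hm : m ∈ Metric.closedBall (0 : StrongDual 𝕜 Y) 1) : ‖m.comp T‖ ≤ ‖T‖ :=
  (m.opNorm_comp_le T).trans
    (mul_le_of_le_one_left (norm_nonneg T) (mem_closedBall_zero_iff.1 hm))

lemma isOpen_smallMaximizers (ε : ℝ) : IsOpen (smallMaximizers 𝕜 X Y ε) := by
  rw [Metric.isOpen_iff]
  rintro T ⟨η, hη, c, h⟩
  refine ⟨η / 3, by positivity, fun S hS => ⟨η / 3, by positivity, c, fun m hm hSm => h m hm ?_⟩⟩
  rw [mem_ball_iff_norm] at hS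
  have h1 := norm_comp_le_of_mem_closedBall (S - T) hm
  have h2 := norm_sub_norm_le T S
  rw [norm_sub_rev] at h2
  have h3 := norm_sub_norm_le (m.comp S) (m.comp T)
  rw [← ContinuousLinearMap.comp_sub] at h3
  linarith

/-- In a nontrivial space every vector is a nonnegative multiple of a unit vector. -/
lemma exists_norm_eq_one_and_eq_smul [Nontrivial X] (v : X) :
    ∃ w : X, ‖w‖ = 1 ∧ v = (‖v‖ : 𝕜) • w := by
  rcases eq_or_ne v 0 with rfl | hv
  · obtain ⟨u, hu⟩ := exists_ne (0 : X)
    exact ⟨((‖u‖ : 𝕜)⁻¹) • u, norm_smul_inv_norm hu, by simp⟩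
  · refine ⟨((‖v‖ : 𝕜)⁻¹) • v, norm_smul_inv_norm hv, ?_⟩
    rw [smul_smul, mul_inv_cancel₀ (by simpa using hv), one_smul]

/-- A rank one perturbation of a given operator has small sets of almost maximizers. -/
lemma exists_smulRight_add_mem_smallMaximizers [CompleteSpace Y]
    [TopologicalSpace.SeparableSpace (StrongDual 𝕜 Y)] [Nontrivial X] (T : X →L[𝕜] Y) {ε r : ℝ}
    (hε : 0 < ε) (hr : 0 < r) :
    ∃ (f : StrongDual 𝕜 X) (y : Y), ‖f.smulRight y‖ < r ∧
      T + f.smulRight y ∈ smallMaximizers 𝕜 X Y ε := by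
  have hb := Metric.isBounded_closedBall (x := (0 : StrongDual 𝕜 Y)) (r := 1)
  have hφ : BddAbove ((fun m : StrongDual 𝕜 Y => ‖m.comp T‖) '' Metric.closedBall 0 1) :=
    ⟨‖T‖, by rintro _ ⟨m, hm, rfl⟩; exact norm_comp_le_of_mem_closedBall T hm⟩
  have hne : (Metric.closedBall (0 : StrongDual 𝕜 Y) 1).Nonempty := ⟨0, by simp⟩
  obtain ⟨y, hy, η, hη, c, h⟩ := stegall_of_separable_dual hne hb hφ
    (Metric.isOpen_ball (x := (0 : Y)) (ε := r)) ⟨0, by simpa using hr⟩ hε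
  set p := conjSup (Metric.closedBall (0 : StrongDual 𝕜 Y) 1) (fun m => ‖m.comp T‖) y
  have hrot : ∀ m ∈ Metric.closedBall (0 : StrongDual 𝕜 Y) 1, ∃ θ : 𝕜, ‖θ‖ = 1 ∧
      θ • m ∈ Metric.closedBall (0 : StrongDual 𝕜 Y) 1 ∧ (θ • m) y = (‖m y‖ : 𝕜) ∧
      ‖(θ • m).comp T‖ = ‖m.comp T‖ := fun m hm => by
    obtain ⟨θ, hθ, h⟩ := RCLike.exists_norm_eq_mul_self (m y)
    refine ⟨θ, hθ, by simpa [norm_smul, hθ] using hm, h.symm, ?_⟩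
    rw [ContinuousLinearMap.smul_comp, norm_smul, hθ, one_mul]
  obtain ⟨m₀, hm₀, hlt₀⟩ := exists_conjSup_lt (φ := fun m => ‖m.comp T‖) hne y
    (show 0 < η / 2 by positivity)
  obtain ⟨θ₀, hθ₀, hθm₀, hpos₀, hn₀⟩ := hrot m₀ hm₀
  -- With `f` in the direction of `m₀ ∘ T`, the bound `‖m ∘ (T + f ⊗ y)‖ ≤ ‖m ∘ T‖ + |m y|` is an
  -- equality at the rotated `m₀`. Almost maximizers for the new operator are then, after rotation,
  -- near-maximizers in Stegall's principle.
  obtain ⟨f, hf, hTf⟩ := exists_norm_eq_one_and_eq_smul (𝕜 := 𝕜) ((θ₀ • m₀).comp T)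
  have hcomp : ∀ m : StrongDual 𝕜 Y, m.comp (T + f.smulRight y) = m.comp T + m y • f := fun m => by
    ext x
    simp [mul_comm]
  refine ⟨f, y, ?_, η / 2, by positivity, c, fun m hm hlt => ?_⟩
  · rw [ContinuousLinearMap.norm_smulRight_apply, hf, one_mul]
    simpa using hy
  have hlow : p - η / 2 ≤ ‖T + f.smulRight y‖ := by
    refine le_trans ?_ (norm_comp_le_of_mem_closedBall _ hθm₀)
    rw [hcomp, hTf, hpos₀, ← add_smul, norm_smul, hf, mul_one, hn₀, ← RCLike.ofReal_add,
      RCLike.norm_ofReal]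
    have := RCLike.re_le_norm (m₀ y)
    exact le_trans (by linarith) (le_abs_self _)
  obtain ⟨θ, hθ, hθm, hpos, hn⟩ := hrot m hm
  refine ⟨θ, hθ, h _ hθm ?_⟩
  rw [hn, hpos, RCLike.ofReal_re]
  have h1 : ‖m.comp (T + f.smulRight y)‖ ≤ ‖m.comp T‖ + ‖m y‖ := by
    rw [hcomp]
    refine (norm_add_le _ _).trans ?_
    rw [norm_smul, hf, mul_one]
  linarith

/-- Sequences of functionals that asymptotically maximize `‖m ∘ T‖` have convergent
subsequences. -/
lemma exists_subseq_tendsto_of_smallMaximizers {T : X →L[𝕜] Y}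
    (hT : ∀ n : ℕ, T ∈ smallMaximizers 𝕜 X Y (1 / (n + 1))) {m : ℕ → StrongDual 𝕜 Y}
    (hm : ∀ n, m n ∈ Metric.closedBall (0 : StrongDual 𝕜 Y) 1)
    (hlim : Tendsto (fun n => ‖(m n).comp T‖) atTop (𝓝 ‖T‖)) :
    ∃ a ∈ Metric.closedBall (0 : StrongDual 𝕜 Y) 1, ∃ k : ℕ → ℕ, StrictMono k ∧
      Tendsto (m ∘ k) atTop (𝓝 a) := by
  have htb : TotallyBounded (Set.range m) := by
    rw [Metric.totallyBounded_iff]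
    intro ε hε
    obtain ⟨n, hn⟩ := exists_nat_one_div_lt (show 0 < ε / 2 by positivity)
    obtain ⟨η, hη, c, h⟩ := hT n
    -- All but finitely many terms are near the compact orbit of `c` under rotations.
    have hK : IsCompact ((fun θ : 𝕜 => θ • c) '' Metric.sphere 0 1) :=
      (isCompact_sphere 0 1).image (by fun_prop)
    obtain ⟨t, ht, htK⟩ := Metric.totallyBounded_iff.1 hK.totallyBounded (ε / 2) (by positivity)
    obtain ⟨N, hN⟩ := eventually_atTop.1 (hlim.eventually (lt_mem_nhds (sub_lt_self ‖T‖ hη)))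
    refine ⟨t ∪ m '' Set.Iio N, ht.union ((Set.finite_Iio N).image m), ?_⟩
    rintro _ ⟨j, rfl⟩
    rcases lt_or_ge j N with hj | hj
    · exact Set.mem_biUnion (Or.inr ⟨j, hj, rfl⟩) (Metric.mem_ball_self hε)
    obtain ⟨θ, hθ, hd⟩ := h _ (hm j) (hN j hj)
    have hθ0 : θ ≠ 0 := norm_ne_zero_iff.1 (by rw [hθ]; exact one_ne_zero)
    obtain ⟨a, ha, hac⟩ := Set.mem_iUnion₂.1 (htK ⟨θ⁻¹, by simp [hθ], rfl⟩)
    refine Set.mem_biUnion (Or.inl ha) ?_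
    have h1 : dist (m j) (θ⁻¹ • c) = dist (θ • m j) c := by
      rw [dist_eq_norm, dist_eq_norm, ← one_mul ‖m j - θ⁻¹ • c‖, ← hθ, ← norm_smul, smul_sub,
        smul_inv_smul₀ hθ0]
    rw [Metric.mem_ball] at hac ⊢
    linarith [dist_triangle (m j) (θ⁻¹ • c) a]
  obtain ⟨a, -, k, hk, hka⟩ := (htb.closure.isCompact_of_isClosed isClosed_closure).tendsto_subseq
    fun n => subset_closure (Set.mem_range_self n)
  exact ⟨a, Metric.isClosed_closedBall.mem_of_tendsto hka (Eventually.of_forall fun n => hm _),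
    k, hk, hka⟩

/-- Suitable rotations of `a` and of `b` lie close to a common functional at every scale, so `b` is
in the closure of the rotation orbit of `a`, which is compact. -/
lemma eq_smul_of_smallMaximizers {T : X →L[𝕜] Y}
    (hT : ∀ n : ℕ, T ∈ smallMaximizers 𝕜 X Y (1 / (n + 1))) {a b : StrongDual 𝕜 Y}
    (ha : a ∈ Metric.closedBall (0 : StrongDual 𝕜 Y) 1) (haT : ‖a.comp T‖ = ‖T‖)
    (hb : b ∈ Metric.closedBall (0 : StrongDual 𝕜 Y) 1) (hbT : ‖b.comp T‖ = ‖T‖) :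
    ∃ θ : 𝕜, ‖θ‖ = 1 ∧ b = θ • a := by
  have hK : IsCompact ((fun θ : 𝕜 => θ • a) '' Metric.sphere 0 1) :=
    (isCompact_sphere 0 1).image (by fun_prop)
  have hmem : b ∈ (fun θ : 𝕜 => θ • a) '' Metric.sphere 0 1 := by
    rw [← hK.isClosed.closure_eq, Metric.mem_closure_iff]
    intro ε hε
    obtain ⟨n, hn⟩ := exists_nat_one_div_lt (show 0 < ε / 2 by positivity)
    obtain ⟨η, hη, c, h⟩ := hT n
    obtain ⟨θ, hθ, hθa⟩ := h a ha (by linarith)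
    obtain ⟨ξ, hξ, hξb⟩ := h b hb (by linarith)
    have hξ0 : ξ ≠ 0 := norm_ne_zero_iff.1 (by rw [hξ]; exact one_ne_zero)
    refine ⟨(ξ⁻¹ * θ) • a, ⟨_, by simp [hθ, hξ], rfl⟩, ?_⟩
    have h1 : dist b ((ξ⁻¹ * θ) • a) = dist (ξ • b) (θ • a) := by
      rw [dist_eq_norm, dist_eq_norm, ← one_mul ‖b - (ξ⁻¹ * θ) • a‖, ← hξ, ← norm_smul, smul_sub,
        mul_smul, smul_inv_smul₀ hξ0]
    linarith [dist_triangle_right (ξ • b) (θ • a) c]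
  obtain ⟨θ, hθ, h⟩ := hmem
  exact ⟨θ, by simpa using hθ, h.symm⟩

/-- The adjoint of an operator with arbitrarily small sets of almost maximizers attains its norm
at a strongly exposed point. -/
theorem exists_strExp_norm_comp_eq [Nontrivial Y] {T : X →L[𝕜] Y}
    (hT : ∀ n : ℕ, T ∈ smallMaximizers 𝕜 X Y (1 / (n + 1))) :
    ∃ a ∈ strExp 𝕜 (Metric.closedBall (0 : StrongDual 𝕜 Y) 1), ‖a.comp T‖ = ‖T‖ ∧ T ≠ 0 := by
  have hcont : Continuous fun m : StrongDual 𝕜 Y => m.comp T :=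
    ((ContinuousLinearMap.compL 𝕜 X Y 𝕜).flip T).continuous
  have hmax : ∀ n : ℕ, ∃ m ∈ Metric.closedBall (0 : StrongDual 𝕜 Y) 1,
      ‖T‖ - 1 / (n + 1 : ℝ) ≤ ‖m.comp T‖ := fun n => by
    rcases (norm_nonneg T).eq_or_lt with h0 | h0
    · refine ⟨0, by simp, ?_⟩
      rw [← h0]
      have : (0 : ℝ) < 1 / (n + 1 : ℝ) := by positivity
      linarith [norm_nonneg ((0 : StrongDual 𝕜 Y).comp T)]
    obtain ⟨x, hx, hlt⟩ := T.exists_lt_apply_of_lt_opNorm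
      (sub_lt_self ‖T‖ (show (0 : ℝ) < 1 / (n + 1 : ℝ) by positivity))
    obtain ⟨g, hg, hgx⟩ := exists_dual_vector'' 𝕜 (T x)
    refine ⟨g, by simpa using hg, ?_⟩
    have h1 := (g.comp T).unit_le_opNorm x hx.le
    rw [ContinuousLinearMap.comp_apply, hgx, RCLike.norm_ofReal, abs_norm] at h1
    linarith
  choose m hm hmT using hmax
  obtain ⟨a, ha, k, hk, hka⟩ := exists_subseq_tendsto_of_smallMaximizers hT hm (by
    refine tendsto_of_tendsto_of_tendsto_of_le_of_le (g := fun n : ℕ => ‖T‖ - 1 / (n + 1 : ℝ)) ?_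
      tendsto_const_nhds hmT (fun n => norm_comp_le_of_mem_closedBall T (hm n))
    simpa using (tendsto_one_div_add_atTop_nhds_zero_nat (𝕜 := ℝ)).const_sub ‖T‖)
  have haT : ‖a.comp T‖ = ‖T‖ := by
    refine le_antisymm (norm_comp_le_of_mem_closedBall T ha) ?_
    have h1 : Tendsto (fun n => ‖(m (k n)).comp T‖) atTop (𝓝 ‖a.comp T‖) :=
      ((hcont.norm).tendsto a).comp hka
    have h2 : Tendsto (fun n : ℕ => ‖T‖ - 1 / (n + 1 : ℝ)) atTop (𝓝 ‖T‖) := by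
      simpa using (tendsto_one_div_add_atTop_nhds_zero_nat (𝕜 := ℝ)).const_sub ‖T‖
    exact le_of_tendsto_of_tendsto' (h2.comp hk.tendsto_atTop) h1 fun n => hmT (k n)
  -- For `T = 0` every functional in the ball is a maximizer, so the ball would be a single rotation
  -- orbit; containing `0`, it would be trivial.
  have hT0 : T ≠ 0 := by
    rintro rfl
    have h0 : ∀ b ∈ Metric.closedBall (0 : StrongDual 𝕜 Y) 1, ∃ θ : 𝕜, ‖θ‖ = 1 ∧ b = θ • a :=
      fun b hb => eq_smul_of_smallMaximizers hT ha haT hb (by simp)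
    have ha0 : a = 0 := by
      obtain ⟨θ, hθ, h⟩ := h0 0 (by simp)
      have hθ0 : θ ≠ 0 := norm_ne_zero_iff.1 (by rw [hθ]; exact one_ne_zero)
      exact (smul_eq_zero.1 h.symm).resolve_left hθ0
    obtain ⟨v, hv⟩ := exists_ne (0 : Y)
    obtain ⟨g, hg, hgv⟩ := exists_dual_vector'' 𝕜 v
    obtain ⟨θ, -, h⟩ := h0 g (by simpa using hg)
    rw [h, ha0] at hgv
    exact hv (by simpa using hgv.symm)
  have hN : 0 < ‖T‖ := norm_pos_iff.2 hT0
  obtain ⟨ψ, hψ, hψa⟩ := exists_dual_vector 𝕜 (a.comp T) (by rw [haT]; exact hN.ne')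
  rw [haT] at hψa
  -- The exposing functional is the biadjoint of `T` at a `ψ` norming `a ∘ T`.
  let f : StrongDual 𝕜 (StrongDual 𝕜 Y) := ψ.comp ((ContinuousLinearMap.compL 𝕜 X Y 𝕜).flip T)
  have hf : ∀ b, f b = ψ (b.comp T) := fun b => rfl
  have hfle : ∀ b, RCLike.re (f b) ≤ ‖b.comp T‖ := fun b => by
    rw [hf]
    refine (RCLike.re_le_norm _).trans ((ψ.le_opNorm _).trans ?_)
    rw [hψ, one_mul]
  have hfa : RCLike.re (f a) = ‖T‖ := by rw [hf, hψa, RCLike.ofReal_re]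
  refine ⟨a, ⟨f, ha, fun b hb => ?_, fun b hb hlim => ?_⟩, haT, hT0⟩
  · rw [hfa]
    exact (hfle b).trans (norm_comp_le_of_mem_closedBall T hb)
  rw [hfa] at hlim
  refine tendsto_of_subseq_tendsto fun ns hns => ?_
  have hlim' := hlim.comp hns
  obtain ⟨a', ha', l, hl, hla⟩ := exists_subseq_tendsto_of_smallMaximizers hT
    (m := b ∘ ns) (fun n => hb _) (tendsto_of_tendsto_of_tendsto_of_le_of_le hlim'
      tendsto_const_nhds (fun n => hfle _) (fun n => norm_comp_le_of_mem_closedBall T (hb _)))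
  have hfa' : RCLike.re (f a') = ‖T‖ := tendsto_nhds_unique
    (((RCLike.continuous_re.comp f.continuous).tendsto a').comp hla)
    (hlim'.comp hl.tendsto_atTop)
  obtain ⟨θ, hθ, rfl⟩ := eq_smul_of_smallMaximizers hT ha haT ha'
    (le_antisymm (norm_comp_le_of_mem_closedBall T ha') (hfa' ▸ hfle a'))
  -- The real part of `f` tells rotations of `a` apart: `re θ * ‖T‖ = ‖T‖` leaves only `θ = 1`.
  have hreθ : RCLike.re θ = 1 := by
    rw [map_smul, hf, hψa, smul_eq_mul, RCLike.re_mul_ofReal] at hfa'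
    exact mul_right_cancel₀ hN.ne' (by rw [hfa', one_mul])
  have hθ1 : θ = 1 := by
    rw [← RCLike.re_eq_self_of_le (a := θ) (by rw [hθ, hreθ]), hreθ, RCLike.ofReal_one]
  rw [hθ1, one_smul] at hla
  exact ⟨l, hla⟩

end

/-! ### Fréchet differentiability and absolute strong exposition -/

section

variable {𝕜 : Type*} [RCLike 𝕜]

lemma NormFrechetDifferentiableAt.of_forall_eventually {E : Type*} [NormedAddCommGroup E]
    [NormedSpace 𝕜 E] {x : E} (G : StrongDual 𝕜 E)
    (h : ∀ ε > 0, ∀ᶠ v in 𝓝 (0 : E), |‖x + v‖ - ‖x‖ - RCLike.re (G v)| ≤ ε * ‖v‖) :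
    NormFrechetDifferentiableAt 𝕜 x := by
  let : NormedSpace ℝ E := NormedSpace.restrictScalars ℝ 𝕜 E
  have : IsScalarTower ℝ 𝕜 E := RestrictScalars.isScalarTower ℝ 𝕜 E
  let Gr : StrongDual ℝ E := RCLike.reCLM.comp (G.restrictScalars ℝ)
  have hd : HasFDerivAt (fun y : E => ‖y‖) Gr x := by
    rw [hasFDerivAt_iff_isLittleO_nhds_zero, Asymptotics.isLittleO_iff]
    exact fun ε hε => h ε hε
  exact hd.differentiableAt

/-- Otherwise points chosen with `η = 1 / (n + 1)` form a maximizing sequence staying away from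
`x₀`. -/
lemma StronglyExposes.exists_forall_dist_lt {E : Type*} [NormedAddCommGroup E]
    [NormedSpace 𝕜 E] {f : StrongDual 𝕜 E} {C : Set E} {x₀ : E} (h : StronglyExposes f C x₀)
    {ε : ℝ} (hε : 0 < ε) :
    ∃ η > 0, ∀ x ∈ C, RCLike.re (f x₀) - η < RCLike.re (f x) → dist x x₀ < ε := by
  by_contra! hcon
  choose x hx hfx hd using fun n : ℕ => hcon (1 / (n + 1)) (by positivity)
  have hlim := h.2.2 x hx (by
    refine tendsto_of_tendsto_of_tendsto_of_le_of_le
      (g := fun n : ℕ => RCLike.re (f x₀) - 1 / (n + 1 : ℝ)) ?_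
      tendsto_const_nhds (fun n => (hfx n).le) (fun n => h.2.1 _ (hx n))
    simpa using (tendsto_one_div_add_atTop_nhds_zero_nat (𝕜 := ℝ)).const_sub (RCLike.re (f x₀)))
  obtain ⟨n, hn⟩ := (Metric.tendsto_nhds.1 hlim ε hε).exists
  exact (hd n).not_gt hn

variable {X : Type*} [NormedAddCommGroup X] [NormedSpace 𝕜 X]
  {Y : Type*} [NormedAddCommGroup Y] [NormedSpace 𝕜 Y]

lemma exists_re_apply_apply_gt (T : X →L[𝕜] Y) {δ : ℝ} (hδ : 0 < δ) :
    ∃ x ∈ Metric.closedBall (0 : X) 1, ∃ g ∈ Metric.closedBall (0 : StrongDual 𝕜 Y) 1,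
      ‖T‖ - δ < RCLike.re (g (T x)) := by
  rcases (norm_nonneg T).eq_or_lt with h0 | h0
  · exact ⟨0, by simp, 0, by simp, by simp [← h0, hδ]⟩
  obtain ⟨x, hx, hlt⟩ := T.exists_lt_apply_of_lt_opNorm (sub_lt_self ‖T‖ hδ)
  obtain ⟨g, hg, hgx⟩ := exists_dual_vector'' 𝕜 (T x)
  exact ⟨x, by simpa using hx.le, g, by simpa using hg, by rwa [hgx, RCLike.ofReal_re]⟩

/-- If the norm of `T` is not increased by small rank one perturbations with values in the kernel
of `c`, then functionals that almost norm `T` are small on the kernel of `c`. -/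
lemma norm_apply_le_of_norm_add_smulRight_le {T : X →L[𝕜] Y} {c : StrongDual 𝕜 Y} {δ : ℝ}
    (hδ : 0 < δ)
    (hker : ∀ (f : StrongDual 𝕜 X) (z : Y), ‖f‖ ≤ 1 → ‖z‖ ≤ δ → c z = 0 →
      ‖T + f.smulRight z‖ ≤ ‖T‖) {η : ℝ} (hη : η ≤ ‖T‖ / 2)
    {x : X} (hx : x ∈ Metric.closedBall (0 : X) 1) {g : StrongDual 𝕜 Y}
    (hg : g ∈ Metric.closedBall (0 : StrongDual 𝕜 Y) 1) (hgx : ‖T‖ - η < RCLike.re (g (T x)))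
    (hT : 0 < ‖T‖) {z : Y} (hz : c z = 0) : ‖g z‖ ≤ 2 * η / δ * ‖z‖ := by
  rcases eq_or_ne z 0 with rfl | hz0
  · simp
  have hzpos : 0 < ‖z‖ := norm_pos_iff.2 hz0
  rw [mem_closedBall_zero_iff] at hg hx
  have hgle : ∀ y, RCLike.re (g y) ≤ ‖y‖ := fun y =>
    (RCLike.re_le_norm _).trans (by simpa using g.le_of_opNorm_le hg y)
  have hxhalf : 1 / 2 ≤ ‖x‖ := by
    have h1 := hgle (T x)
    have h2 := T.le_opNorm x
    have h3 : ‖T‖ * (1 / 2) ≤ ‖T‖ * ‖x‖ := by linarith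
    exact le_of_mul_le_mul_left h3 hT
  obtain ⟨f, hf, hfx⟩ := exists_dual_vector'' 𝕜 x
  obtain ⟨θ, hθ, hθz⟩ := RCLike.exists_norm_eq_mul_self (g z)
  -- The perturbation is the largest allowed one in the direction `z`, rotated so that `g` is
  -- nonnegative on it, with `f` norming `x`. Its effect `‖x‖ * s * ‖g z‖` must be below `η`, and
  -- `‖x‖ ≥ 1 / 2`.
  set s : ℝ := δ / ‖z‖ with hs
  have hspos : 0 < s := by positivity
  have h1 := hker f ((s : 𝕜) • θ • z) hf
    (by rw [norm_smul, norm_smul, hθ, RCLike.norm_ofReal, abs_of_pos hspos, one_mul, hs,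
      div_mul_cancel₀ _ hzpos.ne']) (by simp [hz])
  have h2 : RCLike.re (g ((T + f.smulRight ((s : 𝕜) • θ • z)) x)) =
      RCLike.re (g (T x)) + ‖x‖ * (s * ‖g z‖) := by
    have : g ((T + f.smulRight ((s : 𝕜) • θ • z)) x) =
        g (T x) + ((‖x‖ * (s * ‖g z‖) : ℝ) : 𝕜) := by
      rw [RCLike.ofReal_mul, RCLike.ofReal_mul, hθz]
      simp [hfx]
    rw [this, map_add, RCLike.ofReal_re]
  have h3 := (hgle _).trans ((T + f.smulRight ((s : 𝕜) • θ • z)).unit_le_opNorm x hx)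
  have h4 : (1 / 2) * (s * ‖g z‖) ≤ ‖x‖ * (s * ‖g z‖) := by gcongr
  have h5 : s * ‖g z‖ ≤ 2 * η := by linarith
  rw [hs, div_mul_eq_mul_div, div_le_iff₀ hzpos] at h5
  rw [div_mul_eq_mul_div, le_div_iff₀ hδ]
  linarith

/-- If moreover `c ∘ T` strongly exposes `x₀` and has the norm of `T`, then `T` is almost normed
only near the pair `(x₀, c)`, up to scalars. -/
theorem exists_forall_norm_sub_smul_le {T : X →L[𝕜] Y} {c : StrongDual 𝕜 Y} {δ : ℝ}
    (hδ : 0 < δ)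
    (hker : ∀ (f : StrongDual 𝕜 X) (z : Y), ‖f‖ ≤ 1 → ‖z‖ ≤ δ → c z = 0 →
      ‖T + f.smulRight z‖ ≤ ‖T‖) (hT : 0 < ‖T‖)
    (hc : c ∈ Metric.closedBall (0 : StrongDual 𝕜 Y) 1) (hcT : ‖c.comp T‖ = ‖T‖)
    {x₀ : X} (hexp : StronglyExposes (c.comp T) (Metric.closedBall (0 : X) 1) x₀)
    {ε : ℝ} (hε : 0 < ε) :
    ∃ η > 0, ∀ x ∈ Metric.closedBall (0 : X) 1,
      ∀ g ∈ Metric.closedBall (0 : StrongDual 𝕜 Y) 1, ‖T‖ - η < RCLike.re (g (T x)) →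
      ∃ l : 𝕜, ‖l‖ ≤ 1 ∧ ‖g - l • c‖ ≤ ε ∧ ‖l • x - x₀‖ ≤ ε := by
  have hx₀ := mem_closedBall_zero_iff.1 hexp.1
  have hre := re_apply_eq_norm (c.comp T) hexp.1 hexp.2.1
  rw [hcT] at hre
  have hTx₀ : ‖T x₀‖ ≤ ‖T‖ := T.unit_le_opNorm x₀ hx₀
  have hcTx₀ : c (T x₀) = (‖T‖ : 𝕜) := by
    rw [← hre]
    refine (RCLike.re_eq_self_of_le ?_).symm
    exact ((c.comp T).unit_le_opNorm x₀ hx₀).trans (by rw [hcT]; exact hre.ge)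
  obtain ⟨η₁, hη₁, hexp₁⟩ := hexp.exists_forall_dist_lt hε
  rw [hre] at hexp₁
  set κ := min (ε / 2) (η₁ / (4 * ‖T‖)) with hκ
  have hκpos : 0 < κ := by positivity
  have hκε : 2 * κ ≤ ε := by linarith [min_le_left (ε / 2) (η₁ / (4 * ‖T‖))]
  have hκη : 2 * κ * ‖T‖ ≤ η₁ / 2 := by
    have h := min_le_right (ε / 2) (η₁ / (4 * ‖T‖))
    rw [le_div_iff₀ (by positivity)] at h
    linarith
  set η := min (‖T‖ / 2) (min (η₁ / 2) (δ * κ / 2)) with hη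
  have hη1 : η ≤ ‖T‖ / 2 := min_le_left _ _
  have hη2 : η ≤ η₁ / 2 := (min_le_right _ _).trans (min_le_left _ _)
  have hη3 : η ≤ δ * κ / 2 := (min_le_right _ _).trans (min_le_right _ _)
  refine ⟨η, by positivity, fun x hx g hg hgx => ?_⟩
  have hgker : ∀ z, c z = 0 → ‖g z‖ ≤ κ * ‖z‖ := fun z hz => by
    refine (norm_apply_le_of_norm_add_smulRight_le hδ hker hη1 hx hg hgx hT hz).trans ?_
    gcongr
    rw [div_le_iff₀ hδ]
    linarith
  have hN : (‖T‖ : 𝕜) ≠ 0 := by simpa using norm_pos_iff.1 hT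
  rw [mem_closedBall_zero_iff] at hg hc
  -- `l • c` agrees with `g` on `T x₀`. Since `c (T x₀) = ‖T‖`, the space splits as `𝕜 • T x₀` plus
  -- `ker c`, where `g` is small; the projection onto `ker c` has norm at most `2`.
  set l : 𝕜 := g (T x₀) / (‖T‖ : 𝕜) with hl
  have hl1 : ‖l‖ ≤ 1 := by
    rw [hl, norm_div, RCLike.norm_ofReal, abs_norm, div_le_one hT]
    exact (by simpa using g.le_of_opNorm_le hg (T x₀) : ‖g (T x₀)‖ ≤ ‖T x₀‖).trans hTx₀
  have hgl : ‖g - l • c‖ ≤ 2 * κ := by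
    refine ContinuousLinearMap.opNorm_le_bound _ (by positivity) fun v => ?_
    have hcv : ‖c v‖ ≤ ‖v‖ := by simpa using c.le_of_opNorm_le hc v
    have h1 : (g - l • c) v = g (v - (c v / (‖T‖ : 𝕜)) • T x₀) := by
      simp only [sub_apply, smul_apply, map_sub, map_smul, smul_eq_mul, hl]
      ring
    have h2 : c (v - (c v / (‖T‖ : 𝕜)) • T x₀) = 0 := by
      rw [map_sub, map_smul, hcTx₀, smul_eq_mul, div_mul_cancel₀ _ hN, sub_self]
    have h3 : ‖v - (c v / (‖T‖ : 𝕜)) • T x₀‖ ≤ 2 * ‖v‖ := by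
      refine (norm_sub_le _ _).trans ?_
      rw [norm_smul, norm_div, RCLike.norm_ofReal, abs_norm, div_mul_eq_mul_div]
      have : ‖c v‖ * ‖T x₀‖ / ‖T‖ ≤ ‖v‖ := by
        rw [div_le_iff₀ hT]
        gcongr
      linarith
    rw [h1]
    refine (hgker _ h2).trans ?_
    nlinarith
  refine ⟨l, hl1, hgl.trans hκε, ?_⟩
  rw [← dist_eq_norm]
  rw [mem_closedBall_zero_iff] at hx
  refine (hexp₁ (l • x) ?_ ?_).le
  · rw [mem_closedBall_zero_iff, norm_smul]
    exact mul_le_one₀ hl1 (norm_nonneg x) hx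
  -- As `g` is close to `l • c`, the vector `l • x` almost maximizes `c ∘ T` and is caught by strong
  -- exposition.
  · have h1 : RCLike.re ((g - l • c) (T x)) ≤ 2 * κ * ‖T‖ :=
      (RCLike.re_le_norm _).trans (((g - l • c).le_of_opNorm_le hgl _).trans (by
        gcongr; exact T.unit_le_opNorm x hx))
    have h2 : (c.comp T) (l • x) = (l • c) (T x) := by simp
    rw [h2]
    rw [sub_apply, map_sub] at h1
    linarith

/-- Fréchet differentiability of the operator norm at an operator that is almost normed only
near one pair. -/
theorem normFrechetDifferentiableAt_of_forall_norm_sub_smul_le {T : X →L[𝕜] Y}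
    {c : StrongDual 𝕜 Y} (hc : c ∈ Metric.closedBall (0 : StrongDual 𝕜 Y) 1)
    {x₀ : X} (hx₀ : x₀ ∈ Metric.closedBall (0 : X) 1) (hcT : RCLike.re (c (T x₀)) = ‖T‖)
    (h : ∀ ε > 0, ∃ η > 0, ∀ x ∈ Metric.closedBall (0 : X) 1,
      ∀ g ∈ Metric.closedBall (0 : StrongDual 𝕜 Y) 1, ‖T‖ - η < RCLike.re (g (T x)) →
      ∃ l : 𝕜, ‖l‖ ≤ 1 ∧ ‖g - l • c‖ ≤ ε ∧ ‖l • x - x₀‖ ≤ ε) :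
    NormFrechetDifferentiableAt 𝕜 T := by
  rw [mem_closedBall_zero_iff] at hc hx₀
  have hle : ∀ (g : StrongDual 𝕜 Y) (x : X) (S : X →L[𝕜] Y) {a b : ℝ}, ‖g‖ ≤ a → ‖x‖ ≤ b →
      0 ≤ a → RCLike.re (g (S x)) ≤ a * b * ‖S‖ := fun g x S a b hg hx ha =>
    (RCLike.re_le_norm _).trans ((g.le_of_opNorm_le hg _).trans (by
      rw [mul_assoc, mul_comm b]
      gcongr
      exact S.le_opNorm_of_le hx))
  refine .of_forall_eventually (c.comp (ContinuousLinearMap.apply 𝕜 Y x₀)) fun ε hε => ?_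
  obtain ⟨η, hη, hη'⟩ := h (ε / 3) (by positivity)
  -- A pair that norms `T + S` up to `ε / 3 * ‖S‖` norms `T` up to `(2 + ε / 3) * ‖S‖`, which must
  -- be below `η`.
  filter_upwards [Metric.ball_mem_nhds (0 : X →L[𝕜] Y)
    (show 0 < η / (2 + ε / 3) by positivity)] with S hS
  rw [mem_ball_zero_iff, lt_div_iff₀ (by positivity)] at hS
  change |‖T + S‖ - ‖T‖ - RCLike.re (c (S x₀))| ≤ ε * ‖S‖
  rcases eq_or_ne S 0 with rfl | hS0
  · simp
  have hSpos : 0 < ‖S‖ := norm_pos_iff.2 hS0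
  have hlow : ‖T‖ + RCLike.re (c (S x₀)) ≤ ‖T + S‖ := by
    have h1 := hle c x₀ (T + S) hc hx₀ zero_le_one
    rw [add_apply, map_add, map_add, hcT] at h1
    linarith
  obtain ⟨x, hx, g, hg, hgx⟩ := exists_re_apply_apply_gt (T + S)
    (show 0 < ε / 3 * ‖S‖ by positivity)
  rw [add_apply, map_add, map_add] at hgx
  have hg' := mem_closedBall_zero_iff.1 hg
  have hx' := mem_closedBall_zero_iff.1 hx
  have hgS := hle g x S hg' hx' zero_le_one
  have hgT := hle g x T hg' hx' zero_le_one
  have htri : ‖T‖ ≤ ‖T + S‖ + ‖S‖ := by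
    simpa using norm_sub_le (T + S) S
  obtain ⟨l, hl, hgl, hlx⟩ := hη' x hx g hg (by linarith)
  -- `g (S x) - c (S x₀)` is the sum of `(g - l • c) (S x)` and `c (S (l • x - x₀))`, each at most
  -- `ε / 3 * ‖S‖` in real part.
  have h1 := hle (g - l • c) x S hgl hx' (by positivity)
  have h2 := hle c (l • x - x₀) S hc hlx zero_le_one
  simp only [sub_apply, smul_apply, map_sub, map_smul] at h1 h2
  rw [abs_le]
  constructor <;> nlinarith

/-- Since `‖x₀‖ = 1`, the scalar `l` has modulus close to `1` and may be replaced by its phase. -/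
theorem mem_ASE_of_forall_norm_sub_smul_le {T : X →L[𝕜] Y}
    {c : StrongDual 𝕜 Y} {x₀ : X} (hx₀ : ‖x₀‖ = 1)
    (h : ∀ ε > 0, ∃ η > 0, ∀ x ∈ Metric.closedBall (0 : X) 1,
      ∀ g ∈ Metric.closedBall (0 : StrongDual 𝕜 Y) 1, ‖T‖ - η < RCLike.re (g (T x)) →
      ∃ l : 𝕜, ‖l‖ ≤ 1 ∧ ‖g - l • c‖ ≤ ε ∧ ‖l • x - x₀‖ ≤ ε) :
    T ∈ ASE 𝕜 X Y := by
  refine ⟨x₀, by simp [hx₀], fun x hx hlim => ?_⟩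
  -- The best rotation is used because the phase of `l` depends on `ε`, whereas one sequence of
  -- rotations has to serve all `ε`.
  have hrot : ∀ n, ∃ θ : 𝕜, ‖θ‖ = 1 ∧ ∀ ξ : 𝕜, ‖ξ‖ = 1 →
      ‖θ • x n - x₀‖ ≤ ‖ξ • x n - x₀‖ := fun n => by
    obtain ⟨θ, hθ, hmin⟩ := (isCompact_sphere (0 : 𝕜) 1).exists_isMinOn ⟨1, by simp⟩
      (f := fun θ : 𝕜 => ‖θ • x n - x₀‖) (by fun_prop)
    exact ⟨θ, by simpa using hθ, fun ξ hξ => hmin (by simpa using hξ)⟩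
  choose θ hθ hmin using hrot
  refine ⟨θ, hθ, ?_⟩
  rw [Metric.tendsto_nhds]
  intro ε hε
  obtain ⟨η, hη, hη'⟩ := h (ε / 3) (by positivity)
  filter_upwards [hlim.eventually (lt_mem_nhds (sub_lt_self ‖T‖ hη))] with n hn
  obtain ⟨g, hg, hgx⟩ := exists_dual_vector'' 𝕜 (T (x n))
  obtain ⟨l, hl, -, hlx⟩ := hη' (x n) (hx n) g (by simpa using hg)
    (by rwa [hgx, RCLike.ofReal_re])
  have hxn := mem_closedBall_zero_iff.1 (hx n)
  obtain ⟨ξ, hξ, hξl⟩ := exists_norm_eq_one_and_eq_smul (𝕜 := 𝕜) l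
  have h1 : ‖ξ • x n - l • x n‖ ≤ 1 - ‖l‖ := by
    nth_rw 1 [hξl]
    rw [smul_eq_mul, ← sub_smul, ← one_sub_mul, norm_smul, norm_mul, hξ, mul_one,
      ← RCLike.ofReal_one, ← RCLike.ofReal_sub, RCLike.norm_ofReal, abs_of_nonneg (by linarith)]
    exact mul_le_of_le_one_right (by linarith) hxn
  have h2 : 1 - ‖l‖ ≤ ε / 3 := by
    have h3 := norm_sub_norm_le x₀ (l • x n)
    rw [norm_sub_rev, norm_smul, hx₀] at h3
    have h4 : ‖l‖ * ‖x n‖ ≤ ‖l‖ := mul_le_of_le_one_right (norm_nonneg l) hxn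
    linarith
  rw [dist_eq_norm]
  have h5 := norm_sub_le_norm_sub_add_norm_sub (ξ • x n) (l • x n) x₀
  linarith [hmin n ξ hξ]

end

/-! ### Preduals of `ℓ₁` -/

section

variable {𝕜 : Type*} [RCLike 𝕜]

lemma StronglyExposes.eq_of_le {E : Type*} [NormedAddCommGroup E] [NormedSpace 𝕜 E]
    {f : StrongDual 𝕜 E} {C : Set E} {x₀ x : E} (h : StronglyExposes f C x₀) (hx : x ∈ C)
    (hle : RCLike.re (f x₀) ≤ RCLike.re (f x)) : x = x₀ := by
  have heq : RCLike.re (f x) = RCLike.re (f x₀) := le_antisymm (h.2.1 x hx) hle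
  exact tendsto_nhds_unique tendsto_const_nhds
    (h.2.2 (fun _ => x) (fun _ => hx) (by rw [heq]; exact tendsto_const_nhds))

lemma separableSpace_lp_one :
    TopologicalSpace.SeparableSpace (lp (fun _ : ℕ => 𝕜) 1) := by
  let W := (Submodule.span 𝕜
    (Set.range fun n : ℕ => (lp.single 1 n 1 : lp (fun _ : ℕ => 𝕜) 1))).topologicalClosure
  have htop : W = ⊤ := Submodule.eq_top_iff'.2 fun a => by
    refine (Submodule.isClosed_topologicalClosure _).mem_of_tendsto
      (lp.hasSum_single ENNReal.one_ne_top a)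
      (Eventually.of_forall fun s => W.sum_mem fun n _ => ?_)
    have : (lp.single 1 n (a n) : lp (fun _ : ℕ => 𝕜) 1) = a n • lp.single 1 n 1 := by
      rw [← lp.single_smul, smul_eq_mul, mul_one]
    rw [this]
    exact W.smul_mem _ (Submodule.le_topologicalClosure _ (Submodule.subset_span ⟨n, rfl⟩))
  have hsep : TopologicalSpace.IsSeparable (W : Set (lp (fun _ : ℕ => 𝕜) 1)) :=
    ((Set.countable_range _).isSeparable.span (R := 𝕜)).closure
  rw [htop] at hsep
  exact TopologicalSpace.isSeparable_univ_iff.1 hsep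

/-- In a space isometric to `ℓ₁` the strongly exposed points of the unit ball are rotations of
the basis vectors. -/
lemma exists_eq_smul_single_of_mem_strExp {E : Type*} [NormedAddCommGroup E] [NormedSpace 𝕜 E]
    (e : E ≃ₗᵢ[𝕜] lp (fun _ : ℕ => 𝕜) 1) {x₀ : E}
    (hx₀ : x₀ ∈ strExp 𝕜 (Metric.closedBall (0 : E) 1)) :
    ∃ n : ℕ, ∃ θ : 𝕜, ‖θ‖ = 1 ∧ x₀ = θ • e.symm (lp.single 1 n 1) := by
  obtain ⟨f, hf⟩ := hx₀
  let b : ℕ → E := fun n => e.symm (lp.single 1 n 1)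
  have hb : ∀ n, ‖b n‖ = 1 := fun n => by
    rw [e.symm.norm_map, lp.norm_single one_pos, norm_one]
  have hθb : ∀ n (θ : 𝕜), ‖θ‖ = 1 → θ • b n ∈ Metric.closedBall (0 : E) 1 := fun n θ hθ => by
    simp [norm_smul, hθ, hb]
  have hM : 0 ≤ RCLike.re (f x₀) := by simpa using hf.2.1 0 (by simp)
  -- If no rotated basis vector reaches the supremum `M`, each nonzero coordinate contributes less
  -- than `‖a n‖ * M`, so the total is less than `‖a‖ * M ≤ M`.
  by_contra! hcon
  have hlt : ∀ n (θ : 𝕜), ‖θ‖ = 1 → RCLike.re (f (θ • b n)) < RCLike.re (f x₀) := fun n θ hθ => by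
    by_contra! hle
    exact hcon n θ hθ (hf.eq_of_le (hθb n θ hθ) hle).symm
  have hMpos : 0 < RCLike.re (f x₀) := by
    have h1 := hlt 0 1 (by simp)
    have h2 := hlt 0 (-1) (by simp)
    rw [one_smul] at h1
    rw [neg_smul, one_smul, map_neg, map_neg] at h2
    linarith
  let a := e x₀
  have hsum : HasSum (fun n => RCLike.re (a n * f (b n))) (RCLike.re (f x₀)) := by
    have hab : ∀ n, e.symm (lp.single 1 n (a n)) = a n • b n := fun n => by
      rw [← map_smul, ← lp.single_smul, smul_eq_mul, mul_one]
    have h1 : HasSum (fun n => a n • b n) x₀ := by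
      have h := (lp.hasSum_single ENNReal.one_ne_top a).map e.symm e.symm.continuous
      rw [e.symm_apply_apply] at h
      exact h.congr_fun fun n => (hab n).symm
    exact RCLike.hasSum_re 𝕜 (by simpa using f.hasSum h1)
  have hnorm : HasSum (fun n => ‖a n‖ * RCLike.re (f x₀)) (‖a‖ * RCLike.re (f x₀)) := by
    have := lp.hasSum_norm (p := 1) (by simp) a
    simp only [ENNReal.toReal_one, Real.rpow_one] at this
    exact this.mul_right _
  have hterm : ∀ n, a n ≠ 0 → RCLike.re (a n * f (b n)) < ‖a n‖ * RCLike.re (f x₀) := fun n hn => by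
    obtain ⟨θ, hθ, hθa⟩ := exists_norm_eq_one_and_eq_smul (𝕜 := 𝕜) (a n)
    have h1 := hlt n θ hθ
    have h2 : a n * f (b n) = (‖a n‖ : 𝕜) * f (θ • b n) := by
      conv_lhs => rw [hθa]
      rw [map_smul, smul_eq_mul, smul_eq_mul, mul_assoc]
    rw [h2, RCLike.re_ofReal_mul]
    exact mul_lt_mul_of_pos_left h1 (norm_pos_iff.2 hn)
  have hle : ∀ n, RCLike.re (a n * f (b n)) ≤ ‖a n‖ * RCLike.re (f x₀) := fun n => by
    rcases eq_or_ne (a n) 0 with h0 | h0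
    · simp [h0]
    · exact (hterm n h0).le
  obtain ⟨n, hn⟩ : ∃ n, a n ≠ 0 := by
    by_contra! h0
    have : HasSum (fun n => RCLike.re (a n * f (b n))) 0 := by simp [h0]
    linarith [this.unique hsum]
  have h1 := hasSum_lt hle (hterm n hn) hsum hnorm
  have h2 : ‖a‖ ≤ 1 := by
    rw [e.norm_map]
    exact mem_closedBall_zero_iff.1 hf.1
  nlinarith

theorem hasRNP_and_countableUpToRotations_of_isPredualOfEllOne {Y : Type*}
    [NormedAddCommGroup Y] [NormedSpace 𝕜 Y] [CompleteSpace Y] (h : IsPredualOfEllOne 𝕜 Y) :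
    HasRNP 𝕜 (StrongDual 𝕜 Y) ∧
      CountableUpToRotations 𝕜 (strExp 𝕜 (Metric.closedBall (0 : StrongDual 𝕜 Y) 1)) := by
  obtain ⟨e⟩ := h
  have := separableSpace_lp_one (𝕜 := 𝕜)
  have : TopologicalSpace.SeparableSpace (StrongDual 𝕜 Y) :=
    e.symm.surjective.denseRange.separableSpace e.symm.continuous
  refine ⟨hasRNP_of_separable_dual, .of_subset
    (Set.countable_range fun n : ℕ => e.symm (lp.single 1 n 1)) fun a ha => ?_⟩
  obtain ⟨n, θ, hθ, h⟩ := exists_eq_smul_single_of_mem_strExp e ha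
  exact ⟨_, ⟨n, rfl⟩, θ, hθ, h⟩

end

/-! ### Category arguments in the operator space -/

section

variable {𝕜 : Type*} [RCLike 𝕜] {X : Type*} [NormedAddCommGroup X] [NormedSpace 𝕜 X]
  {Y : Type*} [NormedAddCommGroup Y] [NormedSpace 𝕜 Y]

/-- Composition with a functional, as a map on a subspace of operators. -/
noncomputable def compSubtype (I : Submodule 𝕜 (X →L[𝕜] Y)) (c : StrongDual 𝕜 Y) :
    I →L[𝕜] StrongDual 𝕜 X :=
  (ContinuousLinearMap.compL 𝕜 X Y 𝕜 c).comp I.subtypeL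

@[simp]
lemma compSubtype_apply (I : Submodule 𝕜 (X →L[𝕜] Y)) (c : StrongDual 𝕜 Y) (T : I) :
    compSubtype I c T = c.comp (T : X →L[𝕜] Y) := rfl

/-- Choosing `y` with `c y ≠ 0`, the map `f ↦ f ⊗ (y / c y)` is a continuous right inverse; its
translates give a section through every `T`. -/
lemma isOpenMap_compSubtype {I : Submodule 𝕜 (X →L[𝕜] Y)}
    (hrank : ∀ (f : StrongDual 𝕜 X) (y : Y), f.smulRight y ∈ I) {c : StrongDual 𝕜 Y}
    (hc : c ≠ 0) : IsOpenMap (compSubtype I c) := by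
  obtain ⟨y, hy⟩ : ∃ y, c y ≠ 0 := by
    by_contra! h
    exact hc (ContinuousLinearMap.ext h)
  let R : StrongDual 𝕜 X → I := fun f => ⟨f.smulRight ((c y)⁻¹ • y), hrank _ _⟩
  have hR : Continuous R := by
    refine Continuous.subtype_mk ?_ _
    exact ((ContinuousLinearMap.smulRightL 𝕜 X Y).flip ((c y)⁻¹ • y)).continuous
  have hcR : ∀ f, compSubtype I c (R f) = f := fun f => by
    ext x
    simp [R, hy]
  refine IsOpenMap.of_sections fun T => ⟨fun f => T + R (f - compSubtype I c T), ?_, ?_, fun f => ?_⟩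
  · fun_prop
  · ext x
    simp [R]
  · rw [map_add, hcR, add_sub_cancel]

variable [CompleteSpace Y] {I : Submodule 𝕜 (X →L[𝕜] Y)} [CompleteSpace I]

/-- Residually many operators of `I` have an adjoint attaining its norm at a point of a given
countable set that meets all rotation classes of strongly exposed points. -/
theorem exists_isGδ_dense_forall_exists_norm_comp_eq [Nontrivial X] [Nontrivial Y]
    (hrank : ∀ (f : StrongDual 𝕜 X) (y : Y), f.smulRight y ∈ I)
    (hRNP : HasRNP 𝕜 (StrongDual 𝕜 Y))
    (hcount : CountableUpToRotations 𝕜 (strExp 𝕜 (Metric.closedBall (0 : StrongDual 𝕜 Y) 1))) :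
    ∃ D : Set (StrongDual 𝕜 Y), D.Countable ∧ (∀ c ∈ D, c ≠ 0 ∧ ‖c‖ ≤ 1) ∧
      ∃ G : Set I, IsGδ G ∧ Dense G ∧
        ∀ T ∈ G, ∃ c ∈ D, ‖c.comp (T : X →L[𝕜] Y)‖ = ‖(T : X →L[𝕜] Y)‖ := by
  have := separableSpace_of_countableUpToRotations_strExp hRNP hcount
  obtain ⟨C, hCsub, hC, hrot⟩ := hcount
  let G : ℕ → Set I := fun n =>
    Subtype.val ⁻¹' smallMaximizers 𝕜 X Y (1 / ((n : ℝ) + 1))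
  have hGo : ∀ n, IsOpen (G n) := fun n => 
    (isOpen_smallMaximizers _).preimage continuous_subtype_val
  have hGd : ∀ n, Dense (G n) := fun n => Metric.dense_iff.2 fun T r hr => by
    have hn : (0 : ℝ) < 1 / ((n : ℝ) + 1) := by positivity
    obtain ⟨f, y, hfy, hmem⟩ := exists_smulRight_add_mem_smallMaximizers T.1 hn hr
    let S : I := ⟨f.smulRight y, hrank f y⟩
    have hS : dist (T + S) T < r := by
      rw [dist_eq_norm, add_sub_cancel_left]
      exact hfy
    exact ⟨T + S, hS, hmem⟩
  -- The zero functional is discarded because composition with it is not open.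
  refine ⟨{c ∈ C | c ≠ 0}, hC.mono (Set.sep_subset _ _), fun c hc => ⟨hc.2, ?_⟩, ⋂ n, G n,
    .iInter_of_isOpen hGo, dense_iInter_of_isOpen hGo hGd, fun T hT => ?_⟩
  · obtain ⟨f, hf⟩ := hCsub hc.1
    exact mem_closedBall_zero_iff.1 hf.1
  obtain ⟨a, ha, haT, hT0⟩ := exists_strExp_norm_comp_eq (T := (T : X →L[𝕜] Y))
    fun n => Set.mem_iInter.1 hT n
  obtain ⟨c, hc, θ, hθ, rfl⟩ := hrot a ha
  rw [ContinuousLinearMap.smul_comp, norm_smul, hθ, one_mul] at haT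
  refine ⟨c, ⟨hc, ?_⟩, haT⟩
  rintro rfl
  rw [ContinuousLinearMap.zero_comp, norm_zero] at haT
  exact hT0 (norm_eq_zero.1 haT.symm)

/-- If `‖c ∘ T‖ = ‖T‖` with `‖c‖ ≤ 1`, then `T` attains its norm wherever `c ∘ T` does. -/
theorem setOf_mem_NA_mem_residual [Nontrivial X] [Nontrivial Y]
    (hrank : ∀ (f : StrongDual 𝕜 X) (y : Y), f.smulRight y ∈ I)
    (hRNP : HasRNP 𝕜 (StrongDual 𝕜 Y))
    (hcount : CountableUpToRotations 𝕜 (strExp 𝕜 (Metric.closedBall (0 : StrongDual 𝕜 Y) 1)))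
    (hNA : NA 𝕜 X 𝕜 ∈ residual (StrongDual 𝕜 X)) :
    {T : I | (T : X →L[𝕜] Y) ∈ NA 𝕜 X Y} ∈ residual I := by
  obtain ⟨D, hD, hDc, G, hG, hGd, hGD⟩ :=
    exists_isGδ_dense_forall_exists_norm_comp_eq hrank hRNP hcount
  have hpre : ∀ c ∈ D, compSubtype I c ⁻¹' NA 𝕜 X 𝕜 ∈ residual I := fun c hc =>
    tendsto_residual_of_isOpenMap (compSubtype I c).continuous
      (isOpenMap_compSubtype hrank (hDc c hc).1) hNA
  filter_upwards [residual_of_dense_Gδ hG hGd, (countable_bInter_mem hD).2 hpre] with T hTG hTD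
  obtain ⟨c, hc, hcT⟩ := hGD T hTG
  obtain ⟨x, hx, hxT⟩ := Set.mem_iInter₂.1 hTD c hc
  refine ⟨x, hx, le_antisymm ?_ ((T : X →L[𝕜] Y).unit_le_opNorm x hx.le)⟩
  rw [← hcT]
  refine hxT.trans_le ?_
  simpa using c.le_of_opNorm_le (hDc c hc).2 ((T : X →L[𝕜] Y) x)

/-- The zero functional is maximal at every point of the ball, so it exposes none. This later
excludes `T = 0`. -/
lemma zero_notMem_SE [Nontrivial X] : (0 : StrongDual 𝕜 X) ∉ SE 𝕜 X := by
  rintro ⟨x₀, h⟩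
  obtain ⟨w, hw, -⟩ := exists_norm_eq_one_and_eq_smul (𝕜 := 𝕜) (0 : X)
  have h1 := h.eq_of_le (x := w) (by simp [hw]) (by simp)
  have h2 := h.eq_of_le (x := 0) (by simp) (by simp)
  rw [h1, ← h2, norm_zero] at hw
  exact zero_ne_one hw

/-- The operator is sought in the interior of some `F c`, where the norm coincides locally with `‖c
∘ T‖`; preimages of dense sets under the open map `T ↦ c ∘ T` are dense. -/
theorem dense_setOf_normFrechetDifferentiableAt_and_mem_ASE [Nontrivial X] [Nontrivial Y]
    (hrank : ∀ (f : StrongDual 𝕜 X) (y : Y), f.smulRight y ∈ I)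
    (hRNP : HasRNP 𝕜 (StrongDual 𝕜 Y))
    (hcount : CountableUpToRotations 𝕜 (strExp 𝕜 (Metric.closedBall (0 : StrongDual 𝕜 Y) 1)))
    (hSE : Dense (SE 𝕜 X)) :
    Dense {T : I | NormFrechetDifferentiableAt 𝕜 (T : X →L[𝕜] Y) ∧
      (T : X →L[𝕜] Y) ∈ ASE 𝕜 X Y} := by
  obtain ⟨D, hD, hDc, G, hG, hGd, hGD⟩ :=
    exists_isGδ_dense_forall_exists_norm_comp_eq hrank hRNP hcount
  let F : StrongDual 𝕜 Y → Set I := fun c =>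
    {T | ‖c.comp (T : X →L[𝕜] Y)‖ = ‖(T : X →L[𝕜] Y)‖}
  have hF : ∀ c ∈ D, IsClosed (F c) := fun c _ =>
    isClosed_eq (compSubtype I c).continuous.norm continuous_subtype_val.norm
  have hdense := hG.dense_biUnion_interior_of_closed hGd hD hF fun T hT => by
    obtain ⟨c, hc, hcT⟩ := hGD T hT
    exact Set.mem_biUnion hc hcT
  rw [dense_iff_inter_open]
  intro O hO hOne
  obtain ⟨T', hT'O, hT'⟩ := hdense.inter_open_nonempty O hO hOne
  obtain ⟨c, hc, hT'c⟩ := Set.mem_iUnion₂.1 hT'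
  obtain ⟨hc0, hc1⟩ := hDc c hc
  obtain ⟨T, ⟨hTO, hTF⟩, x₀, hexp⟩ := (hSE.preimage (isOpenMap_compSubtype hrank hc0)).inter_open_nonempty
    (O ∩ interior (F c)) (hO.inter isOpen_interior) ⟨T', hT'O, hT'c⟩
  refine ⟨T, hTO, ?_⟩
  have hcT : ‖c.comp (T : X →L[𝕜] Y)‖ = ‖(T : X →L[𝕜] Y)‖ :=
    (interior_subset hTF : T ∈ F c)
  have hTpos : 0 < ‖(T : X →L[𝕜] Y)‖ := by
    refine (norm_nonneg _).lt_of_ne fun h0 => zero_notMem_SE (𝕜 := 𝕜) (X := X) ⟨x₀, ?_⟩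
    have : compSubtype I c T = 0 := norm_eq_zero.1 (hcT.trans h0.symm)
    rwa [this] at hexp
  obtain ⟨r, hr, hball⟩ := Metric.isOpen_iff.1 isOpen_interior T hTF
  -- Such a perturbation leaves `c ∘ T` unchanged and stays in `F c`, so both operators have norm
  -- `‖c ∘ T‖`.
  have hker : ∀ (f : StrongDual 𝕜 X) (z : Y), ‖f‖ ≤ 1 → ‖z‖ ≤ r / 2 → c z = 0 →
      ‖(T : X →L[𝕜] Y) + f.smulRight z‖ ≤ ‖(T : X →L[𝕜] Y)‖ := fun f z hf hz hcz => by
    have hmem : T + ⟨f.smulRight z, hrank f z⟩ ∈ F c := by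
      refine interior_subset (hball ?_)
      rw [mem_ball_iff_norm, add_sub_cancel_left]
      change ‖f.smulRight z‖ < r
      rw [ContinuousLinearMap.norm_smulRight_apply]
      have : ‖f‖ * ‖z‖ ≤ 1 * (r / 2) := by gcongr
      linarith
    have hcomp : c.comp ((T : X →L[𝕜] Y) + f.smulRight z) = c.comp (T : X →L[𝕜] Y) := by
      ext x
      simp [hcz]
    change ‖c.comp ((T : X →L[𝕜] Y) + f.smulRight z)‖ = ‖(T : X →L[𝕜] Y) + f.smulRight z‖ at hmem
    rw [← hmem, hcomp, hcT]
  have hcB : c ∈ Metric.closedBall (0 : StrongDual 𝕜 Y) 1 := mem_closedBall_zero_iff.2 hc1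
  have hmax := fun (ε : ℝ) (hε : ε > 0) => exists_forall_norm_sub_smul_le (half_pos hr) hker hTpos
    hcB hcT hexp hε
  have hre := re_apply_eq_norm _ hexp.1 hexp.2.1
  rw [compSubtype_apply, hcT, ContinuousLinearMap.comp_apply] at hre
  have hx₀ := mem_closedBall_zero_iff.1 hexp.1
  refine ⟨normFrechetDifferentiableAt_of_forall_norm_sub_smul_le hcB hexp.1 hre hmax,
    mem_ASE_of_forall_norm_sub_smul_le (le_antisymm hx₀ ?_) hmax⟩
  have h1 : ‖(T : X →L[𝕜] Y)‖ ≤ ‖(T : X →L[𝕜] Y)‖ * ‖x₀‖ := by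
    nth_rw 1 [← hre]
    refine (RCLike.re_le_norm _).trans ((c.le_of_opNorm_le hc1 _).trans ?_)
    rw [one_mul]
    exact (T : X →L[𝕜] Y).le_opNorm x₀
  exact le_of_mul_le_mul_left (by rwa [mul_one]) hTpos

end

theorem mainTheorem11 {𝕜 : Type*} [RCLike 𝕜]
    {X : Type*} [NormedAddCommGroup X] [NormedSpace 𝕜 X] [CompleteSpace X]
    {Y : Type*} [NormedAddCommGroup Y] [NormedSpace 𝕜 Y] [CompleteSpace Y] :
    (∀ I : Submodule 𝕜 (X →L[𝕜] Y), IsClosed (I : Set (X →L[𝕜] Y)) →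
      (∀ (f : StrongDual 𝕜 X) (y : Y), f.smulRight y ∈ I) →
      HasRNP 𝕜 (StrongDual 𝕜 Y) →
      CountableUpToRotations 𝕜 (strExp 𝕜 (Metric.closedBall (0 : StrongDual 𝕜 Y) 1)) →
      (NA 𝕜 X 𝕜 ∈ residual (StrongDual 𝕜 X) →
        {T : I | (T : X →L[𝕜] Y) ∈ NA 𝕜 X Y} ∈ residual I) ∧
      (Dense (SE 𝕜 X) →
        Dense {T : I | NormFrechetDifferentiableAt 𝕜 (T : X →L[𝕜] Y)} ∧
        (Nontrivial Y → Dense {T : I | (T : X →L[𝕜] Y) ∈ ASE 𝕜 X Y}))) ∧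
    (IsPredualOfEllOne 𝕜 Y →
      HasRNP 𝕜 (StrongDual 𝕜 Y) ∧
      CountableUpToRotations 𝕜 (strExp 𝕜 (Metric.closedBall (0 : StrongDual 𝕜 Y) 1))) := by
  refine ⟨fun I hI hrank hRNP hcount => ?_, hasRNP_and_countableUpToRotations_of_isPredualOfEllOne⟩
  have := hI.completeSpace_coe
  -- If `X` or `Y` is trivial, the norm is constant on the zero operator space.
  have hFD : Subsingleton (X →L[𝕜] Y) →
      Dense {T : I | NormFrechetDifferentiableAt 𝕜 (T : X →L[𝕜] Y)} := fun _ => by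
    refine dense_univ.mono fun T _ => .of_forall_eventually 0 fun ε _ => .of_forall fun v => ?_
    simp [Subsingleton.elim v 0]
  refine ⟨fun hNA => ?_, fun hSE => ?_⟩
  -- A residual set is nonempty by Baire, and a norm attaining functional needs a unit vector, so
  -- `X` is nontrivial.
  · obtain ⟨f, x, hx, -⟩ := (dense_of_mem_residual hNA).nonempty
    have : Nontrivial X := ⟨x, 0, fun h => by simp [h] at hx⟩
    rcases subsingleton_or_nontrivial Y with hY | hY
    · refine mem_of_superset univ_mem fun T _ => ⟨x, hx, ?_⟩
      rw [Subsingleton.elim (T : X →L[𝕜] Y) 0]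
      simp
    · exact setOf_mem_NA_mem_residual hrank hRNP hcount hNA
  rcases subsingleton_or_nontrivial X with hX | hX
  · refine ⟨hFD inferInstance, fun _ => dense_univ.mono fun T _ => ⟨0, by simp, fun x _ _ =>
      ⟨fun _ => 1, by simp, ?_⟩⟩⟩
    simpa only [Subsingleton.elim _ (0 : X)] using tendsto_const_nhds
  rcases subsingleton_or_nontrivial Y with hY | hY
  · exact ⟨hFD inferInstance, fun h => (not_subsingleton Y hY).elim⟩
  have h := dense_setOf_normFrechetDifferentiableAt_and_mem_ASE hrank hRNP hcount hSE
  exact ⟨h.mono fun T hT => hT.1, fun _ => h.mono fun T hT => hT.2⟩
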